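/- **Theorem (vexillary Grothendieck polynomials).** Let $n\ge 0$ and let $w\in S_n$ be vexillary, i.e. there are no $a<b<c<d$ with $w(b)<w(a)<w(d)<w(c)$. Then the Grothendieck polynomial of $w$ is the flagged Grothendieck polynomial of its shape and flagging: $$\mathcal G_w = G_{\lambda(w),f(w)}\quad\text{in } \mathbb Z[\beta][x_1,x_2,\dots].$$ In detail, there is exactly one partition $\lambda(w)$ as in (b), there is at least one flagging set as in (c), and the equality holds for the flagging $f(w)$ given by any flagging set of $w$. The notions are as follows. (a) Let $\ell$ be the length on $S_n$ (the number of inversions), $s_i$ the transposition of $i$ and $i+1$, and $$\pi_i(g)=\frac{(1+\beta x_{i+1})\,g-(1+\beta x_i)\,s_i(g)}{x_i-x_{i+1}},$$ where $s_i(g)$ is $g$ with $x_i$ and $x_{i+1}$ exchanged. The polynomials $\mathcal G_w$ are defined by $\mathcal G_{w_0}=\prod_{i=1}^{n}x_i^{n-i}$ for the longest element $w_0\in S_n$, and $\mathcal G_w=\pi_i(\mathcal G_{ws_i})$ whenever $\ell(ws_i)=\ell(w)+1$. (b) Let $r_w(p,q)=\#\{i\le p: w(i)\le q\}$, let $D(w)=\{(p,q)\in\{1,\dots,n\}^2: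 w(p)>q,\ w^{-1}(q)>p\}$, and let the essential set $\mathcal Ess(w)$ consist of those $(p,q)\in D(w)$ with $(p+1,q)\notin D(w)$ and $(p,q+1)\notin D(w)$. The shape $\lambda(w)$ is the partition whose Young diagram has, for every $k\in\mathbb Z$, as many boxes $(i,i+k)$ on the $k$-th diagonal as $D(w)$ has. (c) Let $r$ be the number of parts of $\lambda(w)$. A flagging set of $w$ consists of boxes $(p_1,q_1),\dots,(p_r,q_r)\in\{1,\dots,n\}^2$ such that $\mathcal Ess(w)\subseteq\{(p_i,q_i)\}$, $p_1\le\dots\le p_r$, $q_1\ge\dots\ge q_r$, and $p_i-r_w(p_i,q_i)=i$ for all $i$. Its flagging is $f(w)=(p_1,\dots,p_r)$. (d) For a partition $\lambda$ and a flagging $f$, $$G_{\lambda,f}=\sum_T\beta^{|T|-|\lambda|}\prod_{k\in T}x_k ,$$ where $T$ runs over the fillings of the boxes of $\lambda$ by non-empty sets of positive integers, with entries at most $f_i$ in row $i$, such that the maximum of each box is at most the minimum of the box to its right and less than the minimum of the box below it. Here $|T|$ is the total number of entries, with multiplicity, and $|\lambda|$ the number of boxes; $G_{\emptyset}=1$.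 -/

import Mathlib

/-
Indexing convention.  Every positive integer used as an index (a position or a value of a
permutation, a row or a column of a diagram, the index of a variable, an entry of a tableau)
is represented by its predecessor.  So `Equiv.Perm (Fin n)` is the symmetric group on `{1, …, n}`,
and `X k` is the variable `x_{k+1}`.
-/

namespace FlaggedGrothendieck

open MvPolynomial

/-- The polynomial ring `ℤ[β][x₁, x₂, …]`. -/
abbrev Poly : Type := MvPolynomial ℕ (Polynomial ℤ)

/-- The parameter `β`. -/
noncomputable def beta : Poly := C Polynomial.X

/-! ### Divided difference operators -/

/-- The simple transposition `s_i` acting on polynomials by exchanging two adjacent variables. -/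
noncomputable def swapVars (i : ℕ) : Poly →ₐ[Polynomial ℤ] Poly :=
  rename (Equiv.swap i (i + 1))

theorem X_sub_dvd_sub_swapVars (i : ℕ) (f : Poly) :
    (X i - X (i + 1) : Poly) ∣ f - swapVars i f := by
  rw [← Ideal.mem_span_singleton, ← Ideal.Quotient.eq]
  have h : (Ideal.Quotient.mkₐ (Polynomial ℤ) (Ideal.span {(X i - X (i + 1) : Poly)})) =
      (Ideal.Quotient.mkₐ (Polynomial ℤ) (Ideal.span {(X i - X (i + 1) : Poly)})).comp
        (swapVars i) := by
    apply MvPolynomial.algHom_ext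
    intro k
    simp only [AlgHom.comp_apply, swapVars, rename_X, Ideal.Quotient.mkₐ_eq_mk]
    by_cases h1 : k = i
    · subst h1
      rw [Equiv.swap_apply_left, Ideal.Quotient.eq, Ideal.mem_span_singleton]
    · by_cases h2 : k = i + 1
      · subst h2
        rw [Equiv.swap_apply_right, Ideal.Quotient.eq, Ideal.mem_span_singleton]
        exact ⟨-1, by ring⟩
      · rw [Equiv.swap_apply_of_ne_of_ne h1 h2]
  exact DFunLike.congr_fun h f

theorem dividedDiff_exists (i : ℕ) (f : Poly) :
    ∃ g : Poly, (1 + beta * X (i + 1)) * f - (1 + beta * X i) * swapVars i f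
      = (X i - X (i + 1)) * g := by
  obtain ⟨g, hg⟩ := X_sub_dvd_sub_swapVars i f
  exact ⟨(1 + beta * X (i + 1)) * g - beta * swapVars i f,
    by linear_combination (1 + beta * X (i + 1)) * hg⟩

/-- The operator
`π_i f = ((1 + β x_{i+1}) f - (1 + β x_i) s_i f) / (x_i - x_{i+1})`, an exact quotient. -/
noncomputable def dividedDiff (i : ℕ) (f : Poly) : Poly :=
  (dividedDiff_exists i f).choose

theorem dividedDiff_spec (i : ℕ) (f : Poly) :
    (X i - X (i + 1)) * dividedDiff i f
      = (1 + beta * X (i + 1)) * f - (1 + beta * X i) * swapVars i f :=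
  (dividedDiff_exists i f).choose_spec.symm

theorem X_sub_ne_zero {i j : ℕ} (h : i ≠ j) : (X i - X j : Poly) ≠ 0 := by
  intro h0
  exact h (X_injective (R := Polynomial ℤ) (sub_eq_zero.mp h0))

theorem swapVars_beta (i : ℕ) : swapVars i beta = beta := by
  simp [swapVars, beta]

theorem swapVars_X_left (i : ℕ) : swapVars i (X i) = X (i + 1) := by
  simp [swapVars]

theorem swapVars_X_right (i : ℕ) : swapVars i (X (i + 1)) = X i := by
  simp [swapVars]

theorem swapVars_X_ne {i k : ℕ} (h1 : k ≠ i) (h2 : k ≠ i + 1) :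
    swapVars i (X k) = X k := by
  simp [swapVars, Equiv.swap_apply_of_ne_of_ne h1 h2]

theorem swapVars_swapVars (i : ℕ) (f : Poly) : swapVars i (swapVars i f) = f := by
  have : (Equiv.swap i (i + 1) : ℕ → ℕ) ∘ Equiv.swap i (i + 1) = id := by
    funext k; simp
  simp [swapVars, rename_rename, this]

theorem swapVars_comm {i j : ℕ} (h : i + 1 < j) (f : Poly) :
    swapVars i (swapVars j f) = swapVars j (swapVars i f) := by
  simp only [swapVars, rename_rename]
  congr 2
  funext k
  simp only [Function.comp, Equiv.swap_apply_def]
  grind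

theorem swapVars_braid (i : ℕ) (f : Poly) :
    swapVars i (swapVars (i + 1) (swapVars i f))
      = swapVars (i + 1) (swapVars i (swapVars (i + 1) f)) := by
  simp only [swapVars, rename_rename]
  congr 2
  funext k
  simp only [Function.comp, Equiv.swap_apply_def]
  grind

theorem dividedDiff_comm {i j : ℕ} (h : i + 1 < j) (f : Poly) :
    dividedDiff i (dividedDiff j f) = dividedDiff j (dividedDiff i f) := by
  have hij : (X i - X (i + 1) : Poly) ≠ 0 := X_sub_ne_zero (by omega)
  have hjj : (X j - X (j + 1) : Poly) ≠ 0 := X_sub_ne_zero (by omega)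
  have hA := dividedDiff_spec i f
  have hA' := dividedDiff_spec j f
  have hB := dividedDiff_spec j (dividedDiff i f)
  have hB' := dividedDiff_spec i (dividedDiff j f)
  have h1 := congrArg (swapVars j) hA
  have h2 := congrArg (swapVars i) hA'
  have e1 : swapVars j (X i) = X i := swapVars_X_ne (by omega) (by omega)
  have e2 : swapVars j (X (i + 1)) = X (i + 1) := swapVars_X_ne (by omega) (by omega)
  have e3 : swapVars i (X j) = X j := swapVars_X_ne (by omega) (by omega)
  have e4 : swapVars i (X (j + 1)) = X (j + 1) := swapVars_X_ne (by omega) (by omega)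
  simp only [map_mul, map_sub, map_add, map_one, swapVars_beta, e1, e2, e3, e4] at h1 h2
  rw [swapVars_comm h] at h2
  apply mul_left_cancel₀ (mul_ne_zero hij hjj)
  linear_combination (X j - X (j + 1)) * hB' - (X i - X (i + 1)) * hB
    + (1 + beta * X (i + 1)) * hA' - (1 + beta * X i) * h2
    - (1 + beta * X (j + 1)) * hA + (1 + beta * X j) * h1

theorem dividedDiff_braid (i : ℕ) (f : Poly) :
    dividedDiff i (dividedDiff (i + 1) (dividedDiff i f))
      = dividedDiff (i + 1) (dividedDiff i (dividedDiff (i + 1) f)) := by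
  have hxy : (X i - X (i + 1) : Poly) ≠ 0 := X_sub_ne_zero (by omega)
  have hyz : (X (i + 1) - X (i + 1 + 1) : Poly) ≠ 0 := X_sub_ne_zero (by omega)
  have hxz : (X i - X (i + 1 + 1) : Poly) ≠ 0 := X_sub_ne_zero (by omega)
  have e1 : swapVars (i + 1) (X i) = X i := swapVars_X_ne (by omega) (by omega)
  have e2 : swapVars i (X (i + 1 + 1)) = X (i + 1 + 1) := swapVars_X_ne (by omega) (by omega)
  have hA := dividedDiff_spec i f
  have hB := dividedDiff_spec (i + 1) (dividedDiff i f)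
  have hC := dividedDiff_spec i (dividedDiff (i + 1) (dividedDiff i f))
  have hA' := dividedDiff_spec (i + 1) f
  have hB' := dividedDiff_spec i (dividedDiff (i + 1) f)
  have hC' := dividedDiff_spec (i + 1) (dividedDiff i (dividedDiff (i + 1) f))
  have hsA := congrArg (swapVars i) hA
  have htA := congrArg (swapVars (i + 1)) hA
  have hstA := congrArg (swapVars i) htA
  have hsB := congrArg (swapVars i) hB
  have htA' := congrArg (swapVars (i + 1)) hA'
  have hsA' := congrArg (swapVars i) hA'
  have htsA' := congrArg (swapVars (i + 1)) hsA'
  have htB' := congrArg (swapVars (i + 1)) hB'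
  simp only [map_mul, map_sub, map_add, map_one, swapVars_beta, e1, e2, swapVars_X_left,
    swapVars_X_right, swapVars_swapVars] at hsA htA hstA hsB htA' hsA' htsA' htB'
  rw [swapVars_braid] at hstA
  generalize dividedDiff i (dividedDiff (i + 1) (dividedDiff i f)) = c at *
  generalize dividedDiff (i + 1) (dividedDiff i (dividedDiff (i + 1) f)) = c' at *
  generalize (X i : Poly) = x at *
  generalize (X (i + 1) : Poly) = y at *
  generalize (X (i + 1 + 1) : Poly) = z at *
  apply mul_left_cancel₀ (mul_ne_zero (mul_ne_zero (pow_ne_zero 2 hxy) (pow_ne_zero 2 hyz)) hxz)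
  linear_combination
    (y - z) * (hC * (y - z) * (x - z) * (x - y) + hB * (1 + beta * y) * (x - z) * (x - y)
      - hsB * (1 + beta * x) * (y - z) * (x - y)
      + hA * (1 + beta * y) * (1 + beta * z) * (x - z)
      - htA * (1 + beta * y) ^ 2 * (x - y)
      + hsA * (1 + beta * x) * (1 + beta * z) * (y - z)
      + hstA * (1 + beta * x) ^ 2 * (x - y))
    - (x - y) * (hC' * (x - y) * (x - z) * (y - z) + hB' * (1 + beta * z) * (x - z) * (y - z)
      - htB' * (1 + beta * y) * (x - y) * (y - z)
      + hA' * (1 + beta * z) * (1 + beta * y) * (x - z)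
      - hsA' * (1 + beta * z) * (1 + beta * x) * (y - z)
      + htA' * (1 + beta * y) * (1 + beta * z) * (x - y)
      + htsA' * (1 + beta * y) * (1 + beta * x) * (y - z))

/-! ### Permutations and Grothendieck polynomials -/

variable {n : ℕ}

/-- The simple transposition `s_i` in the symmetric group exchanging two adjacent positions
(the identity if `i + 1` is out of range). -/
def simple (n i : ℕ) : Equiv.Perm (Fin n) :=
  if h : i + 1 < n then Equiv.swap ⟨i, by omega⟩ ⟨i + 1, h⟩ else 1

/-- The inversions of `w`. -/
def inversions (w : Equiv.Perm (Fin n)) : Finset (Fin n × Fin n) :=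
  {c | c.1 < c.2 ∧ w c.2 < w c.1}

theorem mem_inversions (w : Equiv.Perm (Fin n)) (c : Fin n × Fin n) :
    c ∈ inversions w ↔ c.1 < c.2 ∧ w c.2 < w c.1 := by
  simp [inversions]

/-- The length `ℓ(w)`, i.e. the number of inversions of `w`. -/
def length (w : Equiv.Perm (Fin n)) : ℕ := (inversions w).card

theorem length_le (w : Equiv.Perm (Fin n)) : length w ≤ n * n := by
  simpa [length] using Finset.card_le_univ (inversions w)

theorem length_mul_simple_of_lt (w : Equiv.Perm (Fin n)) {i : ℕ} (h : i + 1 < n)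
    (hw : w ⟨i, by omega⟩ < w ⟨i + 1, h⟩) : length (w * simple n i) = length w + 1 := by
  set a : Fin n := ⟨i, by omega⟩ with ha
  set b : Fin n := ⟨i + 1, h⟩ with hb
  have hs : simple n i = Equiv.swap a b := by simp [simple, h, ha, hb]
  have hab : a ≠ b := by simp [ha, hb]
  have hset : inversions (w * simple n i) = insert (a, b)
      ((inversions w).map ((Equiv.swap a b).prodCongr (Equiv.swap a b)).toEmbedding) := by
    ext ⟨c, d⟩
    rw [Finset.mem_insert, Finset.mem_map_equiv, hs, mem_inversions, mem_inversions]
    simp only [Equiv.prodCongr_symm, Equiv.prodCongr_apply, Prod.map, Equiv.symm_swap,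
      Equiv.Perm.mul_apply, Prod.mk.injEq]
    have key : c < d ∧ ¬ (c = a ∧ d = b) ↔
        Equiv.swap a b c < Equiv.swap a b d ∧ ¬ (c = b ∧ d = a) := by
      simp only [Equiv.swap_apply_def]
      have h1 : ∀ x : Fin n, x = a ↔ (x : ℕ) = i := fun x => by simp [ha, Fin.ext_iff]
      have h2 : ∀ x : Fin n, x = b ↔ (x : ℕ) = i + 1 := fun x => by simp [hb, Fin.ext_iff]
      have h3 : (a : ℕ) = i := rfl
      have h4 : (b : ℕ) = i + 1 := rfl
      simp only [h1, h2, Fin.lt_def]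
      split_ifs <;> omega
    have hlt : a < b := by simp [ha, hb]
    by_cases h1 : c = a ∧ d = b
    · obtain ⟨rfl, rfl⟩ := h1
      simp [hlt, hw]
    · by_cases h2 : c = b ∧ d = a
      · obtain ⟨rfl, rfl⟩ := h2
        simp [hlt, hlt.le, hw.le, hab.symm]
      · simp only [h1, h2, not_false_eq_true, and_true, false_or] at key ⊢
        rw [key]
  have hnot : (a, b) ∉
      (inversions w).map ((Equiv.swap a b).prodCongr (Equiv.swap a b)).toEmbedding := by
    rw [Finset.mem_map_equiv, mem_inversions]
    have hlt : a < b := by simp [ha, hb]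
    simp [hlt.le]
  rw [length, hset, Finset.card_insert_of_notMem hnot, Finset.card_map, length]

theorem simple_mul_self (n i : ℕ) : simple n i * simple n i = 1 := by
  unfold simple
  split_ifs <;> simp

theorem ascent_iff (w : Equiv.Perm (Fin n)) (i : ℕ) :
    length (w * simple n i) = length w + 1 ↔
      ∃ h : i + 1 < n, w ⟨i, by omega⟩ < w ⟨i + 1, h⟩ := by
  constructor
  · intro hl
    by_cases h : i + 1 < n
    · refine ⟨h, ?_⟩
      by_contra hw
      have hne : w ⟨i, by omega⟩ ≠ w ⟨i + 1, h⟩ := by simp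
      have hs : simple n i = Equiv.swap ⟨i, by omega⟩ ⟨i + 1, h⟩ := by simp [simple, h]
      have h2 := length_mul_simple_of_lt (w * simple n i) h (by
        simp only [Equiv.Perm.mul_apply, hs, Equiv.swap_apply_left, Equiv.swap_apply_right]
        exact lt_of_le_of_ne (not_lt.mp hw) hne.symm)
      rw [mul_assoc, simple_mul_self, mul_one] at h2
      omega
    · simp [simple, h] at hl
  · rintro ⟨h, hw⟩
    exact length_mul_simple_of_lt w h hw

open Classical in
/-- The Grothendieck polynomial `𝒢_w`: it is `∏_i x_i^{n-i}` if `w` is the longest element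
(equivalently, no `s_i` increases the length of `w`), and otherwise `π_i 𝒢_{w s_i}` for some `i`
with `ℓ(w s_i) = ℓ(w) + 1`.  By `grothendieck_revPerm` and `grothendieck_eq` below it obeys the
recursion for every such `i`, so nothing depends on the choice. -/
noncomputable def grothendieck (w : Equiv.Perm (Fin n)) : Poly :=
  if h : ∃ i : ℕ, length (w * simple n i) = length w + 1 then
    dividedDiff h.choose (grothendieck (w * simple n h.choose))
  else ∏ i : Fin n, X (i : ℕ) ^ (n - 1 - (i : ℕ))
termination_by n * n - length w
decreasing_by
  have h1 := h.choose_spec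
  have h2 := length_le (w * simple n h.choose)
  omega

/-- The longest element is the order-reversing permutation. -/
theorem grothendieck_revPerm (n : ℕ) :
    grothendieck (Fin.revPerm : Equiv.Perm (Fin n))
      = ∏ i : Fin n, X (i : ℕ) ^ (n - 1 - (i : ℕ)) := by
  rw [grothendieck, dif_neg]
  rintro ⟨i, hi⟩
  obtain ⟨h, hw⟩ := (ascent_iff _ i).mp hi
  simp only [Fin.revPerm_apply, Fin.rev_lt_rev] at hw
  simp only [Fin.lt_def] at hw
  omega

theorem exists_ascent {w : Equiv.Perm (Fin n)} (hw : w ≠ Fin.revPerm) :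
    ∃ i : ℕ, length (w * simple n i) = length w + 1 := by
  by_contra! hcon
  apply hw
  have hanti : StrictAnti w := by
    cases n with
    | zero => intro a; exact a.elim0
    | succ m =>
      rw [Fin.strictAnti_iff_succ_lt]
      intro i
      have h1 : ¬ ∃ h : (i : ℕ) + 1 < m + 1, w ⟨i, by omega⟩ < w ⟨i + 1, h⟩ :=
        fun hh => hcon i ((ascent_iff w i).mpr hh)
      have h2 : ¬ w i.castSucc < w i.succ := fun hh => h1 ⟨by omega, hh⟩
      exact lt_of_le_of_ne (not_lt.mp h2) (by simp [Fin.ext_iff])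
  have hmono : StrictMono (fun k => Fin.rev (w k)) := fun a b hab => by
    simpa using hanti hab
  have hid : hmono.orderIsoOfSurjective _ (Fin.rev_surjective.comp w.surjective)
      = OrderIso.refl (Fin n) := Subsingleton.elim _ _
  refine Equiv.ext fun k => ?_
  have hk : Fin.rev (w k) = k := DFunLike.congr_fun hid k
  rw [Fin.revPerm_apply, ← Fin.rev_eq_iff, hk]

theorem simple_comm {i j : ℕ} (h : i + 1 < j) :
    simple n i * simple n j = simple n j * simple n i := by
  ext k
  simp only [simple, Equiv.Perm.mul_apply]
  split_ifs <;> simp only [Equiv.swap_apply_def, Equiv.Perm.one_apply, Fin.ext_iff] <;>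
    grind

theorem simple_braid {i : ℕ} (h : i + 2 < n) :
    simple n i * simple n (i + 1) * simple n i
      = simple n (i + 1) * simple n i * simple n (i + 1) := by
  have h1 : i + 1 < n := by omega
  have h2 : i + 1 + 1 < n := by omega
  ext k
  simp only [simple, Equiv.Perm.mul_apply, h1, h2, dif_pos]
  simp only [Equiv.swap_apply_def, Fin.ext_iff]
  grind

theorem grothendieck_eq (w : Equiv.Perm (Fin n)) (i : ℕ)
    (hi : length (w * simple n i) = length w + 1) :
    grothendieck w = dividedDiff i (grothendieck (w * simple n i)) := by
  suffices H : ∀ (m : ℕ) (w : Equiv.Perm (Fin n)), n * n - length w = m → ∀ i j : ℕ, i ≤ j →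
      length (w * simple n i) = length w + 1 → length (w * simple n j) = length w + 1 →
      dividedDiff i (grothendieck (w * simple n i))
        = dividedDiff j (grothendieck (w * simple n j)) by
    rw [grothendieck]
    have hex : ∃ i : ℕ, length (w * simple n i) = length w + 1 := ⟨i, hi⟩
    rw [dif_pos hex]
    rcases le_total hex.choose i with hle | hle
    · exact H _ w rfl _ _ hle hex.choose_spec hi
    · exact (H _ w rfl _ _ hle hi hex.choose_spec).symm
  intro m
  induction m using Nat.strong_induction_on with
  | _ m ih =>
  intro w hm i j hij hi hj
  have step : ∀ (v : Equiv.Perm (Fin n)) (k : ℕ), length w < length v →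
      length (v * simple n k) = length v + 1 →
      grothendieck v = dividedDiff k (grothendieck (v * simple n k)) := by
    intro v k hv hk
    have hex : ∃ i : ℕ, length (v * simple n i) = length v + 1 := ⟨k, hk⟩
    have hle := length_le v
    have hlt : n * n - length v < m := by omega
    rw [grothendieck, dif_pos hex]
    rcases le_total hex.choose k with hle | hle
    · exact ih _ hlt v rfl _ _ hle hex.choose_spec hk
    · exact (ih _ hlt v rfl _ _ hle hk hex.choose_spec).symm
  obtain ⟨hin, hiw⟩ := (ascent_iff w i).mp hi
  obtain ⟨hjn, hjw⟩ := (ascent_iff w j).mp hj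
  have si : simple n i = Equiv.swap ⟨i, by omega⟩ ⟨i + 1, hin⟩ := by simp [simple, hin]
  have sj : simple n j = Equiv.swap ⟨j, by omega⟩ ⟨j + 1, hjn⟩ := by simp [simple, hjn]
  rcases Nat.lt_trichotomy j (i + 1) with hlt | heq | hgt
  · obtain rfl : i = j := by omega
    rfl
  · subst heq
    have hi2 : length (w * simple n i * simple n (i + 1)) = length (w * simple n i) + 1 := by
      refine (ascent_iff _ _).mpr ⟨hjn, ?_⟩
      simp only [Equiv.Perm.mul_apply, si, Equiv.swap_apply_right]
      rw [Equiv.swap_apply_of_ne_of_ne (by simp only [ne_eq, Fin.ext_iff]; omega) (by simp only [ne_eq, Fin.ext_iff]; omega)]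
      exact hiw.trans hjw
    have hi3 : length (w * simple n i * simple n (i + 1) * simple n i)
        = length (w * simple n i * simple n (i + 1)) + 1 := by
      refine (ascent_iff _ _).mpr ⟨hin, ?_⟩
      simp only [Equiv.Perm.mul_apply, si, sj, Equiv.swap_apply_left]
      rw [Equiv.swap_apply_of_ne_of_ne (a := (⟨i + 1, _⟩ : Fin n)) (x := ⟨i, _⟩)
        (by simp only [ne_eq, Fin.ext_iff]; omega) (by simp only [ne_eq, Fin.ext_iff]; omega), Equiv.swap_apply_left,
        Equiv.swap_apply_of_ne_of_ne (by simp only [ne_eq, Fin.ext_iff]; omega) (by simp only [ne_eq, Fin.ext_iff]; omega)]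
      exact hjw
    have hj2 : length (w * simple n (i + 1) * simple n i)
        = length (w * simple n (i + 1)) + 1 := by
      refine (ascent_iff _ _).mpr ⟨hin, ?_⟩
      simp only [Equiv.Perm.mul_apply, sj, Equiv.swap_apply_left]
      rw [Equiv.swap_apply_of_ne_of_ne (by simp only [ne_eq, Fin.ext_iff]; omega) (by simp only [ne_eq, Fin.ext_iff]; omega)]
      exact hiw.trans hjw
    have hj3 : length (w * simple n (i + 1) * simple n i * simple n (i + 1))
        = length (w * simple n (i + 1) * simple n i) + 1 := by
      refine (ascent_iff _ _).mpr ⟨hjn, ?_⟩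
      simp only [Equiv.Perm.mul_apply, si, sj, Equiv.swap_apply_right]
      rw [Equiv.swap_apply_of_ne_of_ne (a := (⟨i, _⟩ : Fin n)) (x := ⟨i + 1 + 1, _⟩)
        (by simp only [ne_eq, Fin.ext_iff]; omega) (by simp only [ne_eq, Fin.ext_iff]; omega), Equiv.swap_apply_right,
        Equiv.swap_apply_of_ne_of_ne (by simp only [ne_eq, Fin.ext_iff]; omega) (by simp only [ne_eq, Fin.ext_iff]; omega)]
      exact hiw
    rw [step _ _ (by omega) hi2, step _ _ (by omega) hi3,
      step _ _ (by omega) hj2, step _ _ (by omega) hj3, dividedDiff_braid]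
    have := simple_braid hjn
    simp only [mul_assoc] at this ⊢
    rw [this]
  · have hi2 : length (w * simple n i * simple n j) = length (w * simple n i) + 1 := by
      refine (ascent_iff _ _).mpr ⟨hjn, ?_⟩
      simp only [Equiv.Perm.mul_apply, si]
      rw [Equiv.swap_apply_of_ne_of_ne, Equiv.swap_apply_of_ne_of_ne]
      · exact hjw
      all_goals simp [Fin.ext_iff]; omega
    have hj2 : length (w * simple n j * simple n i) = length (w * simple n j) + 1 := by
      refine (ascent_iff _ _).mpr ⟨hin, ?_⟩
      simp only [Equiv.Perm.mul_apply, sj]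
      rw [Equiv.swap_apply_of_ne_of_ne, Equiv.swap_apply_of_ne_of_ne]
      · exact hiw
      all_goals simp [Fin.ext_iff]; omega
    rw [step _ _ (by omega) hi2, step _ _ (by omega) hj2, dividedDiff_comm hgt,
      mul_assoc, mul_assoc, simple_comm hgt]

/-! ### Flagged set-valued tableaux -/

/-- The flagged set-valued tableaux of shape `μ` with flagging `f`: fillings of the boxes of `μ` by
non-empty sets, those in row `i` having entries at most `f i`, such that the maximum of a box is
at most the minimum of the box to its right and less than the minimum of the box below it.
Only the values of `f` at the rows of `μ` matter. -/
def FSVT (μ : YoungDiagram) (f : ℕ → ℕ) : Finset (μ.cells → Finset ℕ) :=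
  {T ∈ Fintype.piFinset fun c : μ.cells => (Finset.Iic (f c.1.1)).powerset |
    (∀ c, (T c).Nonempty) ∧
    (∀ c d : μ.cells, d.1 = (c.1.1, c.1.2 + 1) → ∀ a ∈ T c, ∀ b ∈ T d, a ≤ b) ∧
    (∀ c d : μ.cells, d.1 = (c.1.1 + 1, c.1.2) → ∀ a ∈ T c, ∀ b ∈ T d, a < b)}

/-- The flagged Grothendieck polynomial
`G_{μ,f} = ∑_T β^{|T| - |μ|} ∏_{k ∈ T} x_k`, summed over the flagged set-valued tableaux.
(The subtraction does not truncate, since all sets of `T` are non-empty.) -/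
noncomputable def flaggedGrothendieck (μ : YoungDiagram) (f : ℕ → ℕ) : Poly :=
  ∑ T ∈ FSVT μ f, beta ^ ((∑ c, (T c).card) - μ.card) * ∏ c, ∏ k ∈ T c, X k

/-! ### Shape and flaggings of a vexillary permutation -/

/-- `w` is vexillary: it avoids the pattern 2143. -/
def IsVexillary (w : Equiv.Perm (Fin n)) : Prop :=
  ¬ ∃ a b c d : Fin n, a < b ∧ b < c ∧ c < d ∧ w b < w a ∧ w a < w d ∧ w d < w c

/-- The rank function `r_w(p, q) = #{i ≤ p | w(i) ≤ q}`. -/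
def rank (w : Equiv.Perm (Fin n)) (p q : ℕ) : ℕ :=
  Finset.card {i : Fin n | (i : ℕ) ≤ p ∧ (w i : ℕ) ≤ q}

/-- The diagram `D(w)`: the boxes `(p, q)` of the `n × n` grid with `w(p) > q` and
`w⁻¹(q) > p`. -/
def diagram (w : Equiv.Perm (Fin n)) : Finset (ℕ × ℕ) :=
  ({c | c.2 < w c.1 ∧ c.1 < w.symm c.2} : Finset (Fin n × Fin n)).image
    fun c => ((c.1 : ℕ), (c.2 : ℕ))

/-- The essential set of `w`: the southeast corners of the diagram. -/
def essentialSet (w : Equiv.Perm (Fin n)) : Finset (ℕ × ℕ) :=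
  {c ∈ diagram w | (c.1 + 1, c.2) ∉ diagram w ∧ (c.1, c.2 + 1) ∉ diagram w}

/-- `μ` is the shape `λ(w)`: for every `k`, the Young diagram `μ` and the diagram `D(w)` have the
same number of boxes `(i, i + k)` on the `k`-th diagonal. -/
def IsShape (w : Equiv.Perm (Fin n)) (μ : YoungDiagram) : Prop :=
  ∀ k : ℤ, Finset.card {c ∈ μ.cells | (c.2 : ℤ) - (c.1 : ℤ) = k}
    = Finset.card {c ∈ diagram w | (c.2 : ℤ) - (c.1 : ℤ) = k}

/-- The boxes `(p i, q i)`, for `i` among the first `r` indices, form a flagging set of `w`. The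
associated flagging is `p`. -/
structure IsFlaggingSet (w : Equiv.Perm (Fin n)) (r : ℕ) (p q : ℕ → ℕ) : Prop where
  mem_grid : ∀ i < r, p i < n ∧ q i < n
  essentialSet_subset : ∀ c ∈ essentialSet w, ∃ i < r, (p i, q i) = c
  p_mono : ∀ i j, i ≤ j → j < r → p i ≤ p j
  q_anti : ∀ i j, i ≤ j → j < r → q j ≤ q i
  rank_eq : ∀ i < r, (p i : ℤ) - (rank w (p i) (q i) : ℤ) = i

end FlaggedGrothendieck

/-!
The proof compares divided differences of both sides, descending from the longest element.

*Permutations.* The code `c` of `w` counts the boxes in the rows of the diagram. If `w` is vexillary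
then `λ(w)` is the code sorted decreasingly: pushing the boxes of the diagram to the left and
sorting the rows moves every box along its diagonal (`IsVexillary.isShape_codeShape`), because the
values above those of a box, in the rows down to that box, are recognized by the code
(`IsVexillary.lt_iff_boxIndex_lt`). The essential boxes correspond to the corners of `λ(w)`: the one
for a corner in column `j` lies in the last row with more than `j` boxes (`IsCornerBox`). So every
flagging is pinned at the corners, where it equals `colBound w j - 1`, and elsewhere it is large
enough to impose no condition beyond those of the corners (`IsFlaggingSet.isRowBound`,
`IsRowBound.tabSum_eq`). Conversely, any lattice path through all essential boxes contains a
flagging set.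

*Descent.* If `w` is not the longest element, take the leftmost ascent `K < K + 1` among those at
which the code of the right end is maximal. Then `w s_K` is again vexillary, its shape has one more
box, in a corner, and the flags can be chosen so that the row of that corner is the only one with
flag `K`, while for `w` this row has flag `K + 1` and all others are unchanged
(`IsTopAscent.isRowBound`, `IsTopAscent.isRowBound_swap`). For the longest element there is a single
tableau, which gives the monomial.

*Tableaux.* Let row `i` be the only row of `μ` with flag `k`, ending in a corner, and let `μ'` be
`μ` without this corner. Sorting the tableaux of shape `μ`, with the flag of row `i` raised to
`k + 1`, by the content of the corner gives
`G(μ, k+1) = (1 + β x_{k+1}) G(μ, k) + x_{k+1} G(μ', k+1)` (`tabSum_corner`). Both `G(μ, k+1)` and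
`G(μ', k+1)` are symmetric in `x_k` and `x_{k+1}`, as no row has flag `k` (`swapVars_tabSum`), and
applying `s_k` to the relation turns it into `π_k G(μ, k) = G(μ', k+1)` (`dividedDiff_tabSum`).

Throughout, row bounds are strict: a flag `f i` becomes the bound `b i = f i + 1`. This allows the
bound `0`.
-/

namespace FlaggedGrothendieck

open MvPolynomial

/-! ### Set-valued tableaux and their corners -/

/-- The weight `β^{|s|-1} ∏_{k ∈ s} x_k` of a box filled with the set `s`. -/
noncomputable def boxWeight (s : Finset ℕ) : Poly := beta ^ (s.card - 1) * ∏ k ∈ s, X k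

/-- Set-valued tableaux on a finite set `S` of boxes whose entries in row `i` are less than `b i`.
They are total functions, empty outside of `S`, so that shapes can be changed without changing
types. -/
structure IsTableau (S : Finset (ℕ × ℕ)) (b : ℕ → ℕ) (T : ℕ × ℕ → Finset ℕ) : Prop where
  eq_empty : ∀ c ∉ S, T c = ∅
  lt_bound : ∀ i j, ∀ a ∈ T (i, j), a < b i
  nonempty : ∀ c ∈ S, (T c).Nonempty
  row_le : ∀ i j, ∀ a ∈ T (i, j), ∀ e ∈ T (i, j + 1), a ≤ e
  col_lt : ∀ i j, ∀ a ∈ T (i, j), ∀ e ∈ T (i + 1, j), a < e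

theorem IsTableau.mem_of_mem {S : Finset (ℕ × ℕ)} {b : ℕ → ℕ} {T : ℕ × ℕ → Finset ℕ}
    (h : IsTableau S b T) {c : ℕ × ℕ} {a : ℕ} (ha : a ∈ T c) : c ∈ S := by
  by_contra hc
  simp [h.eq_empty c hc] at ha

theorem finite_isTableau (S : Finset (ℕ × ℕ)) (b : ℕ → ℕ) : {T | IsTableau S b T}.Finite := by
  refine Set.Finite.of_injOn (f := fun T (c : S) => T c.1)
    (t := (Fintype.piFinset fun c : S => (Finset.range (b c.1.1)).powerset : Set _))
    ?_ ?_ (Finset.finite_toSet _)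
  · intro T hT
    simp only [Finset.mem_coe, Fintype.mem_piFinset, Finset.mem_powerset]
    intro c a ha
    exact Finset.mem_range.mpr (hT.lt_bound _ _ a ha)
  · intro T hT T' hT' hTT
    funext c
    by_cases hc : c ∈ S
    · exact congrFun hTT ⟨c, hc⟩
    · rw [hT.eq_empty c hc, hT'.eq_empty c hc]

/-- The finite set of all set-valued tableaux on `S` with row bounds `b`. -/
noncomputable def tableaux (S : Finset (ℕ × ℕ)) (b : ℕ → ℕ) : Finset (ℕ × ℕ → Finset ℕ) :=
  (finite_isTableau S b).toFinset

theorem mem_tableaux {S : Finset (ℕ × ℕ)} {b : ℕ → ℕ} {T : ℕ × ℕ → Finset ℕ} :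
    T ∈ tableaux S b ↔ IsTableau S b T := by
  simp [tableaux]

/-- The generating function of the set-valued tableaux on `S` with row bounds `b`. -/
noncomputable def tabSum (S : Finset (ℕ × ℕ)) (b : ℕ → ℕ) : Poly :=
  ∑ T ∈ tableaux S b, ∏ c ∈ S, boxWeight (T c)

theorem IsTableau.exists_row_ge {S : Finset (ℕ × ℕ)} (hS : IsLowerSet (S : Set (ℕ × ℕ)))
    {b : ℕ → ℕ} {T : ℕ × ℕ → Finset ℕ} (h : IsTableau S b T) {i j j' : ℕ} (hj : j' ≤ j)
    (hc : (i, j) ∈ S) {a : ℕ} (ha : a ∈ T (i, j')) : ∃ e ∈ T (i, j), a ≤ e := by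
  induction j, hj using Nat.le_induction with
  | base => exact ⟨a, ha, le_rfl⟩
  | succ j hj ih =>
    obtain ⟨e, he, hae⟩ := ih (hS (Prod.mk_le_mk.mpr ⟨le_rfl, Nat.le_succ j⟩) hc)
    obtain ⟨e', he'⟩ := h.nonempty _ hc
    exact ⟨e', he', hae.trans (h.row_le _ _ _ he _ he')⟩

theorem IsTableau.exists_col_ge {S : Finset (ℕ × ℕ)} (hS : IsLowerSet (S : Set (ℕ × ℕ)))
    {b : ℕ → ℕ} {T : ℕ × ℕ → Finset ℕ} (h : IsTableau S b T) {i j d : ℕ}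
    (hc : (i + d, j) ∈ S) {a : ℕ} (ha : a ∈ T (i, j)) : ∃ e ∈ T (i + d, j), a + d ≤ e := by
  induction d with
  | zero => exact ⟨a, ha, le_rfl⟩
  | succ d ih =>
    obtain ⟨e, he, hae⟩ := ih (hS (Prod.mk_le_mk.mpr ⟨Nat.le_succ _, le_rfl⟩) hc)
    obtain ⟨e', he'⟩ := h.nonempty _ hc
    have := h.col_lt _ _ _ he _ he'
    exact ⟨e', he', by omega⟩

/-- A bound on the entries of a box bounds the entries to the left of it, and more strictly those
above it. So only the bounds at the corners of the shape matter, as long as the other bounds do not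
undercut what the corners imply. -/
theorem tableaux_subset {S : Finset (ℕ × ℕ)} (hS : IsLowerSet (S : Set (ℕ × ℕ))) {b b' : ℕ → ℕ}
    (h : ∀ i j, (i, j) ∈ S → ∃ d l, j ≤ l ∧ (i + d, l) ∈ S ∧ b (i + d) ≤ b' i + d) :
    tableaux S b ⊆ tableaux S b' := by
  intro T hT
  rw [mem_tableaux] at hT ⊢
  refine ⟨hT.eq_empty, ?_, hT.nonempty, hT.row_le, hT.col_lt⟩
  intro i j a ha
  obtain ⟨d, l, hl, hc, hb⟩ := h i j (hT.mem_of_mem ha)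
  obtain ⟨e, he, hae⟩ := hT.exists_row_ge hS hl (hS (Prod.mk_le_mk.mpr ⟨by omega, le_rfl⟩) hc) ha
  obtain ⟨e', he', hee⟩ := hT.exists_col_ge hS hc he
  have := hT.lt_bound _ _ _ he'
  omega

theorem tabSum_congr {S : Finset (ℕ × ℕ)} (hS : IsLowerSet (S : Set (ℕ × ℕ))) {b b' : ℕ → ℕ}
    (h : ∀ i, (i, 0) ∈ S → b i = b' i) : tabSum S b = tabSum S b' := by
  have h' : ∀ i j, (i, j) ∈ S → b i = b' i := fun i j hc =>
    h i (hS (Prod.mk_le_mk.mpr ⟨le_rfl, Nat.zero_le j⟩) hc)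
  have : tableaux S b = tableaux S b' :=
    (tableaux_subset hS fun i j hc => ⟨0, j, le_rfl, hc, (h' i j hc).le⟩).antisymm
      (tableaux_subset hS fun i j hc => ⟨0, j, le_rfl, hc, (h' i j hc).ge⟩)
  rw [tabSum, tabSum, this]

/-- The bound of a row can be lowered to `v` if a box below the last box of the row forces it. -/
theorem tabSum_update_of_forced {S : Finset (ℕ × ℕ)} (hS : IsLowerSet (S : Set (ℕ × ℕ)))
    {b : ℕ → ℕ} {i j d v : ℕ} (hv : v ≤ b i) (hlast : (i, j + 1) ∉ S)
    (hc : (i + d, j) ∈ S) (hb : b (i + d) ≤ v + d) :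
    tabSum S (Function.update b i v) = tabSum S b := by
  have : tableaux S (Function.update b i v) = tableaux S b := by
    apply Finset.Subset.antisymm
    · refine tableaux_subset hS fun i' j' hc' => ⟨0, j', le_rfl, hc', ?_⟩
      by_cases h : i' = i
      · subst h; simpa using hv
      · simp [h]
    · refine tableaux_subset hS fun i' j' hc' => ?_
      by_cases h : i' = i
      · subst h
        refine ⟨d, j, ?_, hc, by simpa using hb⟩
        by_contra hlt
        exact hlast (hS (Prod.mk_le_mk.mpr ⟨le_rfl, by omega⟩) hc')
      · exact ⟨0, j', le_rfl, hc', by simp [h]⟩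
  rw [tabSum, tabSum, this]

theorem isLowerSet_erase {S : Finset (ℕ × ℕ)} (hS : IsLowerSet (S : Set (ℕ × ℕ))) {i j : ℕ}
    (hr : (i, j + 1) ∉ S) (hd : (i + 1, j) ∉ S) :
    IsLowerSet (S.erase (i, j) : Set (ℕ × ℕ)) := by
  rintro ⟨p, q⟩ ⟨p', q'⟩ hle hc
  simp only [Finset.coe_erase, Set.mem_sdiff, Finset.mem_coe, Set.mem_singleton_iff,
    Prod.mk.injEq] at hc ⊢
  refine ⟨hS hle hc.1, ?_⟩
  rintro ⟨rfl, rfl⟩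
  obtain ⟨h1, h2⟩ := Prod.mk_le_mk.mp hle
  rcases Nat.lt_or_ge p' p with h | h
  · exact hd (hS (Prod.mk_le_mk.mpr ⟨h, h2⟩) hc.1)
  · have : p = p' := le_antisymm h h1
    subst this
    rcases Nat.lt_or_ge q' q with h' | h'
    · exact hr (hS (Prod.mk_le_mk.mpr ⟨le_rfl, h'⟩) hc.1)
    · exact hc.2 ⟨rfl, le_antisymm h' h2⟩

theorem boxWeight_insert {k : ℕ} {s : Finset ℕ} (hk : k ∉ s) (hs : s.Nonempty) :
    boxWeight (insert k s) = beta * X k * boxWeight s := by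
  obtain ⟨c, hc⟩ := Nat.exists_eq_add_of_lt hs.card_pos
  rw [boxWeight, boxWeight, Finset.card_insert_of_notMem hk, Finset.prod_insert hk]
  have : s.card - 1 = c := by omega
  have h2 : s.card + 1 - 1 = c + 1 := by omega
  rw [this, h2]
  ring

theorem boxWeight_singleton (k : ℕ) : boxWeight {k} = X k := by
  simp [boxWeight]

theorem prod_boxWeight_update {S : Finset (ℕ × ℕ)} {c : ℕ × ℕ} (hc : c ∈ S)
    (T : ℕ × ℕ → Finset ℕ) (s : Finset ℕ) :
    ∏ x ∈ S, boxWeight (Function.update T c s x)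
      = boxWeight s * ∏ x ∈ S.erase c, boxWeight (T x) := by
  rw [← Finset.mul_prod_erase S _ hc, Function.update_self]
  congr 1
  refine Finset.prod_congr rfl fun x hx => ?_
  rw [Function.update_of_ne (Finset.ne_of_mem_erase hx)]

/-- Sorting the tableaux by whether the largest allowed entry `k` lies in the corner box `(i, j)`,
and if so, alone or not. The bound on the row above ensures that `k` alone can be put into the
corner. -/
theorem tabSum_corner {S : Finset (ℕ × ℕ)} (hS : IsLowerSet (S : Set (ℕ × ℕ))) {b : ℕ → ℕ}
    {i j k : ℕ} (hc : (i, j) ∈ S) (hr : (i, j + 1) ∉ S) (hd : (i + 1, j) ∉ S)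
    (hb : b i = k + 1) (hup : ∀ t, t + 1 = i → b t ≤ k) :
    tabSum S b = (1 + beta * X k) * tabSum S (Function.update b i k)
      + X k * tabSum (S.erase (i, j)) b := by
  classical
  -- the tableaux without `k` in the corner
  have hA : (tableaux S b).filter (fun T => k ∉ T (i, j))
      = tableaux S (Function.update b i k) := by
    ext T
    rw [Finset.mem_filter, mem_tableaux, mem_tableaux]
    constructor
    · rintro ⟨hT, hk⟩
      refine ⟨hT.eq_empty, ?_, hT.nonempty, hT.row_le, hT.col_lt⟩
      intro i' j' a ha
      by_cases h : i' = i
      · subst h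
        have hj' : j' ≤ j := by
          by_contra hlt
          exact hr (hS (Prod.mk_le_mk.mpr ⟨le_rfl, by omega⟩) (hT.mem_of_mem ha))
        obtain ⟨e, he, hae⟩ := hT.exists_row_ge hS hj' hc ha
        have h1 := hT.lt_bound _ _ _ he
        have h2 : e ≠ k := fun h => hk (h ▸ he)
        rw [Function.update_self]
        omega
      · rw [Function.update_of_ne h]
        exact hT.lt_bound _ _ _ ha
    · intro hT
      refine ⟨⟨hT.eq_empty, ?_, hT.nonempty, hT.row_le, hT.col_lt⟩, ?_⟩
      · intro i' j' a ha
        have := hT.lt_bound _ _ _ ha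
        by_cases h : i' = i
        · subst h
          rw [Function.update_self] at this
          omega
        · rwa [Function.update_of_ne h] at this
      · intro hk
        have := hT.lt_bound _ _ _ hk
        simp at this
  have hne : ∀ {i' j'}, (i', j' + 1) = (i, j) → (i', j') ≠ (i, j) := by
    intro i' j' h h'
    simp only [Prod.mk.injEq] at h h'
    omega
  -- the tableaux with `k` and further entries in the corner: remove `k`
  have hB : ∑ T ∈ ((tableaux S b).filter (fun T => k ∈ T (i, j))).filter
        (fun T => T (i, j) ≠ {k}), ∏ c ∈ S, boxWeight (T c)
      = beta * X k * tabSum S (Function.update b i k) := by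
    rw [tabSum, Finset.mul_sum, ← hA]
    refine Finset.sum_bij' (fun T _ => Function.update T (i, j) ((T (i, j)).erase k))
      (fun T _ => Function.update T (i, j) (insert k (T (i, j)))) ?_ ?_ ?_ ?_ ?_
    · intro T hT
      simp only [Finset.mem_filter, mem_tableaux, ne_eq] at hT ⊢
      obtain ⟨⟨hT, hk⟩, hk'⟩ := hT
      have hsub : ∀ c, Function.update T (i, j) ((T (i, j)).erase k) c ⊆ T c := by
        intro c
        by_cases h : c = (i, j)
        · subst h
          rw [Function.update_self]
          exact Finset.erase_subset _ _
        · rw [Function.update_of_ne h]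
      refine ⟨⟨?_, ?_, ?_, ?_, ?_⟩, by simp⟩
      · exact fun c hc' => Finset.subset_empty.mp ((hT.eq_empty c hc') ▸ hsub c)
      · exact fun i' j' a ha => hT.lt_bound _ _ _ (hsub _ ha)
      · intro c hc'
        by_cases h : c = (i, j)
        · subst h
          rw [Function.update_self, Finset.nonempty_iff_ne_empty, Ne, Finset.erase_eq_empty_iff]
          rintro (h | h)
          · simp [h] at hk
          · exact hk' h
        · rw [Function.update_of_ne h]
          exact hT.nonempty c hc'
      · exact fun i' j' a ha e he => hT.row_le _ _ _ (hsub _ ha) _ (hsub _ he)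
      · exact fun i' j' a ha e he => hT.col_lt _ _ _ (hsub _ ha) _ (hsub _ he)
    · intro T hT
      simp only [Finset.mem_filter, mem_tableaux, ne_eq] at hT ⊢
      have hT' : IsTableau S (Function.update b i k) T := by
        rw [← mem_tableaux, ← hA, Finset.mem_filter, mem_tableaux]
        exact hT
      obtain ⟨hT, hk⟩ := hT
      have hmem : ∀ c, c ≠ (i, j) → Function.update T (i, j) (insert k (T (i, j))) c = T c :=
        fun c h => Function.update_of_ne h _ _
      refine ⟨⟨⟨?_, ?_, ?_, ?_, ?_⟩, by simp⟩, ?_⟩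
      · intro c hc'
        rw [hmem c (fun h => hc' (h ▸ hc))]
        exact hT.eq_empty c hc'
      · intro i' j' a ha
        by_cases h : (i', j') = (i, j)
        · rw [h, Function.update_self, Finset.mem_insert] at ha
          obtain ⟨rfl, rfl⟩ := Prod.mk.inj h
          rcases ha with rfl | ha
          · omega
          · exact hT.lt_bound _ _ _ ha
        · rw [hmem _ h] at ha
          exact hT.lt_bound _ _ _ ha
      · intro c hc'
        by_cases h : c = (i, j)
        · subst h; simp
        · rw [hmem c h]; exact hT.nonempty c hc'
      · intro i' j' a ha e he
        by_cases h : (i', j' + 1) = (i, j)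
        · rw [hmem _ (hne h)] at ha
          rw [h, Function.update_self, Finset.mem_insert] at he
          rcases he with rfl | he
          · have := hT'.lt_bound _ _ _ ha
            rw [(Prod.mk.inj h).1, Function.update_self] at this
            exact this.le
          · exact hT.row_le _ _ _ ha _ (h ▸ he)
        · rw [hmem _ h] at he
          by_cases h' : (i', j') = (i, j)
          · obtain ⟨rfl, rfl⟩ := Prod.mk.inj h'
            exact absurd (hT.mem_of_mem he) hr
          · rw [hmem _ h'] at ha
            exact hT.row_le _ _ _ ha _ he
      · intro i' j' a ha e he
        by_cases h : (i' + 1, j') = (i, j)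
        · obtain ⟨rfl, rfl⟩ := Prod.mk.inj h
          rw [hmem _ (by simp)] at ha
          rw [Function.update_self, Finset.mem_insert] at he
          rcases he with rfl | he
          · exact (hT.lt_bound _ _ _ ha).trans_le (hup _ rfl)
          · exact hT.col_lt _ _ _ ha _ he
        · rw [hmem _ h] at he
          by_cases h' : (i', j') = (i, j)
          · obtain ⟨rfl, rfl⟩ := Prod.mk.inj h'
            exact absurd (hT.mem_of_mem he) hd
          · rw [hmem _ h'] at ha
            exact hT.col_lt _ _ _ ha _ he
      · rw [Function.update_self]
        intro h
        obtain ⟨a, ha⟩ := hT.nonempty _ hc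
        have : a ∈ ({k} : Finset ℕ) := h ▸ Finset.mem_insert_of_mem ha
        exact hk (Finset.mem_singleton.mp this ▸ ha)
    · intro T hT
      simp only [Finset.mem_filter] at hT
      simp [Finset.insert_erase hT.1.2]
    · intro T hT
      simp only [Finset.mem_filter] at hT
      simp [Finset.erase_insert hT.2]
    · intro T hT
      simp only [Finset.mem_filter, mem_tableaux, ne_eq] at hT
      obtain ⟨⟨hT, hk⟩, hk'⟩ := hT
      rw [prod_boxWeight_update hc, ← Finset.mul_prod_erase S _ hc, ← mul_assoc,
        ← boxWeight_insert (Finset.notMem_erase _ _), Finset.insert_erase hk]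
      rw [Finset.nonempty_iff_ne_empty, Ne, Finset.erase_eq_empty_iff]
      rintro (h | h)
      · simp [h] at hk
      · exact hk' h
  -- the tableaux with only `k` in the corner: remove the box
  have hC : ∑ T ∈ ((tableaux S b).filter (fun T => k ∈ T (i, j))).filter
        (fun T => ¬ T (i, j) ≠ {k}), ∏ c ∈ S, boxWeight (T c)
      = X k * tabSum (S.erase (i, j)) b := by
    rw [tabSum, Finset.mul_sum]
    refine Finset.sum_bij' (fun T _ => Function.update T (i, j) ∅)
      (fun T _ => Function.update T (i, j) {k}) ?_ ?_ ?_ ?_ ?_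
    · intro T hT
      simp only [Finset.mem_filter, mem_tableaux, ne_eq, not_not] at hT ⊢
      obtain ⟨⟨hT, hk⟩, hk'⟩ := hT
      have hsub : ∀ c, Function.update T (i, j) ∅ c ⊆ T c := by
        intro c
        by_cases h : c = (i, j)
        · subst h; simp
        · rw [Function.update_of_ne h]
      refine ⟨?_, ?_, ?_, ?_, ?_⟩
      · intro c hc'
        by_cases h : c = (i, j)
        · subst h; simp
        · rw [Function.update_of_ne h]
          exact hT.eq_empty c fun h' => hc' (Finset.mem_erase.mpr ⟨h, h'⟩)
      · exact fun i' j' a ha => hT.lt_bound _ _ _ (hsub _ ha)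
      · intro c hc'
        rw [Function.update_of_ne (Finset.ne_of_mem_erase hc')]
        exact hT.nonempty c (Finset.mem_of_mem_erase hc')
      · exact fun i' j' a ha e he => hT.row_le _ _ _ (hsub _ ha) _ (hsub _ he)
      · exact fun i' j' a ha e he => hT.col_lt _ _ _ (hsub _ ha) _ (hsub _ he)
    · intro T hT
      simp only [Finset.mem_filter, mem_tableaux, ne_eq, not_not] at hT ⊢
      have hmem : ∀ c, c ≠ (i, j) → Function.update T (i, j) {k} c = T c :=
        fun c h => Function.update_of_ne h _ _
      refine ⟨⟨⟨?_, ?_, ?_, ?_, ?_⟩, by simp⟩, by simp⟩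
      · intro c hc'
        rw [hmem c (fun h => hc' (h ▸ hc))]
        exact hT.eq_empty c fun h => hc' (Finset.mem_of_mem_erase h)
      · intro i' j' a ha
        by_cases h : (i', j') = (i, j)
        · rw [h, Function.update_self, Finset.mem_singleton] at ha
          obtain ⟨rfl, rfl⟩ := Prod.mk.inj h
          omega
        · rw [hmem _ h] at ha
          exact hT.lt_bound _ _ _ ha
      · intro c hc'
        by_cases h : c = (i, j)
        · subst h; simp
        · rw [hmem c h]; exact hT.nonempty c (Finset.mem_erase.mpr ⟨h, hc'⟩)
      · intro i' j' a ha e he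
        by_cases h : (i', j' + 1) = (i, j)
        · rw [hmem _ (hne h)] at ha
          rw [h, Function.update_self, Finset.mem_singleton] at he
          have := hT.lt_bound _ _ _ ha
          rw [(Prod.mk.inj h).1] at this
          omega
        · rw [hmem _ h] at he
          by_cases h' : (i', j') = (i, j)
          · obtain ⟨rfl, rfl⟩ := Prod.mk.inj h'
            exact absurd (Finset.mem_of_mem_erase (hT.mem_of_mem he)) hr
          · rw [hmem _ h'] at ha
            exact hT.row_le _ _ _ ha _ he
      · intro i' j' a ha e he
        by_cases h : (i' + 1, j') = (i, j)
        · obtain ⟨rfl, rfl⟩ := Prod.mk.inj h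
          rw [hmem _ (by simp)] at ha
          rw [Function.update_self, Finset.mem_singleton] at he
          subst he
          exact (hT.lt_bound _ _ _ ha).trans_le (hup _ rfl)
        · rw [hmem _ h] at he
          by_cases h' : (i', j') = (i, j)
          · obtain ⟨rfl, rfl⟩ := Prod.mk.inj h'
            exact absurd (Finset.mem_of_mem_erase (hT.mem_of_mem he)) hd
          · rw [hmem _ h'] at ha
            exact hT.col_lt _ _ _ ha _ he
    · intro T hT
      simp only [Finset.mem_filter, ne_eq, not_not] at hT
      simp [← hT.2]
    · intro T hT
      rw [mem_tableaux] at hT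
      have := hT.eq_empty (i, j) (Finset.notMem_erase _ _)
      simp [← this]
    · intro T hT
      simp only [Finset.mem_filter, ne_eq, not_not] at hT
      rw [← Finset.mul_prod_erase S _ hc, hT.2, boxWeight_singleton]
      congr 1
      refine Finset.prod_congr rfl fun x hx => ?_
      rw [Function.update_of_ne (Finset.ne_of_mem_erase hx)]
  have h1 := Finset.sum_filter_add_sum_filter_not (tableaux S b) (fun T => k ∈ T (i, j))
    (fun T => ∏ c ∈ S, boxWeight (T c))
  have h2 := Finset.sum_filter_add_sum_filter_not
    ((tableaux S b).filter (fun T => k ∈ T (i, j))) (fun T => T (i, j) ≠ {k})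
    (fun T => ∏ c ∈ S, boxWeight (T c))
  rw [hB, hC] at h2
  rw [hA] at h1
  rw [tabSum, ← h1, ← h2]
  change _ + tabSum S (Function.update b i k) = _
  ring

theorem tabSum_empty (b : ℕ → ℕ) : tabSum ∅ b = 1 := by
  have : tableaux ∅ b = {fun _ => ∅} := by
    ext T
    rw [mem_tableaux, Finset.mem_singleton]
    constructor
    · intro h
      funext c
      exact h.eq_empty c (Finset.notMem_empty c)
    · rintro rfl
      exact ⟨by simp, by simp, by simp, by simp, by simp⟩
  simp [tabSum, this]

/-- The entries in row `i` of a tableau are at least `i`. -/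
theorem tabSum_eq_zero {S : Finset (ℕ × ℕ)} (hS : IsLowerSet (S : Set (ℕ × ℕ))) {b : ℕ → ℕ}
    {i : ℕ} (hc : (i, 0) ∈ S) (hb : b i ≤ i) : tabSum S b = 0 := by
  have : tableaux S b = ∅ := by
    rw [Finset.eq_empty_iff_forall_notMem]
    intro T hT
    rw [mem_tableaux] at hT
    obtain ⟨a, ha⟩ := hT.nonempty (0, 0) (hS (Prod.mk_le_mk.mpr ⟨Nat.zero_le _, le_rfl⟩) hc)
    obtain ⟨e, he, hae⟩ := hT.exists_col_ge hS (i := 0) (d := i) (by simpa using hc) ha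
    have := hT.lt_bound _ _ _ he
    rw [Nat.zero_add] at this
    omega
  simp [tabSum, this]

theorem swapVars_tabSum_of_le {S : Finset (ℕ × ℕ)} {b : ℕ → ℕ} {k : ℕ}
    (hb : ∀ c ∈ S, b c.1 ≤ k) : swapVars k (tabSum S b) = tabSum S b := by
  rw [tabSum, map_sum]
  refine Finset.sum_congr rfl fun T hT => ?_
  rw [mem_tableaux] at hT
  rw [map_prod]
  refine Finset.prod_congr rfl fun c hc => ?_
  rw [boxWeight, map_mul, map_pow, swapVars_beta, map_prod]
  congr 1
  refine Finset.prod_congr rfl fun a ha => ?_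
  have h1 := hT.lt_bound c.1 c.2 a ha
  have h2 := hb c hc
  exact swapVars_X_ne (by omega) (by omega)

/-! ### Symmetry and divided differences of tableau sums -/

theorem exists_last_col {S : Finset (ℕ × ℕ)} {i : ℕ}
    (hc : (i, 0) ∈ S) : ∃ j, (i, j) ∈ S ∧ (i, j + 1) ∉ S := by
  by_contra! h
  have hall : ∀ j, (i, j) ∈ S := fun j => by
    induction j with
    | zero => exact hc
    | succ j ih => exact h j ih
  exact Set.infinite_of_injective_forall_mem (f := fun j : ℕ => (i, j))
    (fun a b hab => (Prod.mk.inj hab).2) hall S.finite_toSet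

theorem exists_last_row {S : Finset (ℕ × ℕ)} {i j : ℕ} (hc : (i, j) ∈ S) :
    ∃ r, i ≤ r ∧ (r, j) ∈ S ∧ ∀ s, (s, j) ∈ S → s ≤ r := by
  obtain ⟨c, hc', hmax⟩ := (S.filter fun c => c.2 = j).exists_max_image Prod.fst
    ⟨(i, j), by simp [hc]⟩
  rw [Finset.mem_filter] at hc'
  refine ⟨c.1, hmax (i, j) (by simp [hc]), ?_, fun s hs => hmax (s, j) (by simp [hs])⟩
  rw [← hc'.2]
  exact hc'.1

/-- A symmetric combination: either both tableau sums agree, or expanding at the corner of row `t`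
trades the first for symmetric ones. -/
theorem swapVars_pair {S : Finset (ℕ × ℕ)} (hS : IsLowerSet (S : Set (ℕ × ℕ))) {b : ℕ → ℕ}
    {t k : ℕ} (ht : b t = k + 2) (hup : ∀ s, s + 1 = t → b s ≤ k)
    (hdown : ∀ s, t < s → (s, 0) ∈ S → b s = k + 2)
    (hsymm : ∀ S' ⊆ S, IsLowerSet (S' : Set (ℕ × ℕ)) →
      swapVars k (tabSum S' b) = tabSum S' b) :
    swapVars k (X k * (1 + beta * X (k + 1)) * tabSum S (Function.update b t (k + 1))
        + X (k + 1) * tabSum S b)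
      = X k * (1 + beta * X (k + 1)) * tabSum S (Function.update b t (k + 1))
        + X (k + 1) * tabSum S b := by
  have hY := hsymm S subset_rfl hS
  have heq : tabSum S (Function.update b t (k + 1)) = tabSum S b →
      swapVars k (X k * (1 + beta * X (k + 1)) * tabSum S (Function.update b t (k + 1))
        + X (k + 1) * tabSum S b)
      = X k * (1 + beta * X (k + 1)) * tabSum S (Function.update b t (k + 1))
        + X (k + 1) * tabSum S b := by
    intro h
    rw [h]
    simp only [map_add, map_mul, map_one, swapVars_beta, swapVars_X_left, swapVars_X_right, hY]
    ring
  by_cases h0 : (t, 0) ∈ S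
  · obtain ⟨j, hj, hj'⟩ := exists_last_col h0
    by_cases h1 : (t + 1, j) ∈ S
    · apply heq
      refine tabSum_update_of_forced hS (d := 1) (by omega) hj' h1 ?_
      rw [hdown (t + 1) (by omega) (hS (Prod.mk_le_mk.mpr ⟨le_rfl, Nat.zero_le _⟩) h1)]
    · have hrec := tabSum_corner hS (k := k + 1) hj hj' h1 ht
        (fun s hs => (hup s hs).trans (Nat.le_succ k))
      have hZ := hsymm _ (Finset.erase_subset (t, j) S) (isLowerSet_erase hS hj' h1)
      have : X k * (1 + beta * X (k + 1)) * tabSum S (Function.update b t (k + 1))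
          + X (k + 1) * tabSum S b
          = (X k + X (k + 1)) * tabSum S b - X k * X (k + 1) * tabSum (S.erase (t, j)) b := by
        linear_combination (-X k) * hrec
      rw [this]
      simp only [map_add, map_sub, map_mul, swapVars_X_left, swapVars_X_right, hY, hZ]
      ring
  · refine heq (tabSum_congr hS fun i hi => ?_)
    rw [Function.update_of_ne]
    rintro rfl
    exact h0 hi

/-- A flagged tableau sum whose row bounds increase weakly is symmetric in `x_k` and `x_{k+1}`
unless some row allows the entry `k` but not `k + 1`. The proof strips boxes off the rows with the
largest bound. -/
theorem swapVars_tabSum {S : Finset (ℕ × ℕ)} (hS : IsLowerSet (S : Set (ℕ × ℕ))) {b : ℕ → ℕ}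
    {k : ℕ} (hmono : ∀ i i', i ≤ i' → (i', 0) ∈ S → b i ≤ b i')
    (hne : ∀ i, (i, 0) ∈ S → b i ≠ k + 1) : swapVars k (tabSum S b) = tabSum S b := by
  induction hN : S.card + ∑ c ∈ S, b c.1 using Nat.strong_induction_on generalizing S b with
  | _ N ih =>
  have IH : ∀ (S' : Finset (ℕ × ℕ)) (b' : ℕ → ℕ), S' ⊆ S → (∀ i, b' i ≤ b i) →
      (S' ≠ S ∨ ∃ t, (t, 0) ∈ S ∧ b' t < b t) → IsLowerSet (S' : Set (ℕ × ℕ)) →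
      (∀ i i', i ≤ i' → (i', 0) ∈ S → b' i ≤ b' i') → (∀ i, (i, 0) ∈ S → b' i ≠ k + 1) →
      swapVars k (tabSum S' b') = tabSum S' b' := by
    intro S' b' hsub hle hlt hS' hm hn
    refine ih _ ?_ hS' (fun i i' h h' => hm i i' h (hsub h')) (fun i h => hn i (hsub h)) rfl
    rw [← hN]
    have h1 : ∑ c ∈ S', b' c.1 ≤ ∑ c ∈ S, b' c.1 := Finset.sum_le_sum_of_subset hsub
    have h2 : ∑ c ∈ S, b' c.1 ≤ ∑ c ∈ S, b c.1 := Finset.sum_le_sum fun c _ => hle c.1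
    rcases hlt with hlt | ⟨t, ht, hlt⟩
    · have := Finset.card_lt_card (Finset.ssubset_iff_subset_ne.mpr ⟨hsub, hlt⟩)
      omega
    · have := Finset.card_le_card hsub
      have h3 : ∑ c ∈ S, b' c.1 < ∑ c ∈ S, b c.1 :=
        Finset.sum_lt_sum (fun c _ => hle c.1) ⟨(t, 0), ht, hlt⟩
      omega
  by_cases hbase : ∀ c ∈ S, b c.1 ≤ k
  · exact swapVars_tabSum_of_le hbase
  push Not at hbase
  obtain ⟨⟨i₀, j₀⟩, hc₀, hb₀⟩ := hbase
  have hc₀' : (i₀, 0) ∈ S := hS (Prod.mk_le_mk.mpr ⟨le_rfl, Nat.zero_le _⟩) hc₀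
  obtain ⟨r, hir, hr, hrmax⟩ := exists_last_row hc₀'
  have hbr : k + 2 ≤ b r := by
    have h1 := hmono _ _ hir hr
    have h2 := hne r hr
    simp only at hb₀
    omega
  have hex : ∃ t, b t = b r := ⟨r, rfl⟩
  -- `r` is the last row, and `t` the first row with the same bound as `r`
  set t := Nat.find hex with htdef
  have ht : b t = b r := Nat.find_spec hex
  have htr : t ≤ r := Nat.find_min' hex rfl
  have ht0 : (t, 0) ∈ S := hS (Prod.mk_le_mk.mpr ⟨htr, le_rfl⟩) hr
  have habove : ∀ s, s < t → b s < b r := fun s hs =>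
    lt_of_le_of_ne (hmono _ _ (by omega) hr) (Nat.find_min hex hs)
  have hbelow : ∀ s, t ≤ s → (s, 0) ∈ S → b s = b r := fun s hs hsS =>
    le_antisymm (hmono _ _ (hrmax s hsS) hr) (ht ▸ hmono _ _ hs hsS)
  have hcol : ∀ {i j}, (i, j) ∈ S → (i, 0) ∈ S := fun h =>
    hS (Prod.mk_le_mk.mpr ⟨le_rfl, Nat.zero_le _⟩) h
  obtain ⟨j, hj, hj'⟩ := exists_last_col ht0
  -- lowering the bound of row `t`
  have hmono' : ∀ v, (∀ s, s < t → b s ≤ v) → v ≤ b r → ∀ i i', i ≤ i' → (i', 0) ∈ S →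
      Function.update b t v i ≤ Function.update b t v i' := by
    intro v hv hvr i i' hii hi'
    by_cases h : i = t <;> by_cases h' : i' = t
    · simp [h, h']
    · rw [h, Function.update_self, Function.update_of_ne h', hbelow i' (h ▸ hii) hi']
      exact hvr
    · rw [h', Function.update_self, Function.update_of_ne h]
      exact hv i (by omega)
    · rw [Function.update_of_ne h, Function.update_of_ne h']
      exact hmono _ _ hii hi'
  have hle' : ∀ v, v ≤ b r → ∀ i, Function.update b t v i ≤ b i := by
    intro v hv i
    by_cases h : i = t
    · rw [h, Function.update_self, ht]
      exact hv
    · rw [Function.update_of_ne h]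
  have hne' : ∀ v, v ≠ k + 1 → ∀ i, (i, 0) ∈ S → Function.update b t v i ≠ k + 1 := by
    intro v hv i hi
    by_cases h : i = t
    · rwa [h, Function.update_self]
    · rw [Function.update_of_ne h]
      exact hne i hi
  rcases Nat.lt_or_ge (k + 2) (b r) with hbig | hsmall
  -- the largest entry of row `t` is fixed by `s_k`: strip it off, or see that it cannot occur
  · obtain ⟨K, hK⟩ : ∃ K, b r = K + 1 := ⟨b r - 1, by omega⟩
    have hA : swapVars k (tabSum S (Function.update b t K)) = tabSum S (Function.update b t K) :=
      IH S _ subset_rfl (hle' K (by omega)) (Or.inr ⟨t, ht0, by rw [Function.update_self]; omega⟩)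
        hS (hmono' K (fun s hs => by have := habove s hs; omega) (by omega))
        (hne' K (by omega))
    by_cases h1 : (t + 1, j) ∈ S
    · have hf := tabSum_update_of_forced hS (b := b) (d := 1) (v := K) (by omega) hj' h1
        (by rw [hbelow (t + 1) (by omega) (hcol h1)]; omega)
      rwa [hf] at hA
    · have hZ : swapVars k (tabSum (S.erase (t, j)) b) = tabSum (S.erase (t, j)) b :=
        IH _ b (Finset.erase_subset _ _) (fun _ => le_rfl)
          (Or.inl fun h => (Finset.erase_eq_self.mp h) hj) (isLowerSet_erase hS hj' h1) hmono hne
      rw [tabSum_corner hS hj hj' h1 (ht.trans hK)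
        (fun s hs => by have := habove s (by omega); omega)]
      simp only [map_add, map_mul, map_one, swapVars_beta, hA, hZ,
        swapVars_X_ne (show K ≠ k by omega) (show K ≠ k + 1 by omega)]
  · have hB : b r = k + 2 := by omega
    have habove' : ∀ s, s < t → b s ≤ k := by
      intro s hs
      have h1 := habove s hs
      have h2 := hne s (hS (Prod.mk_le_mk.mpr ⟨by omega, le_rfl⟩) ht0)
      omega
    have hQ : swapVars k (tabSum S (Function.update b t k)) = tabSum S (Function.update b t k) :=
      IH S _ subset_rfl (hle' k (by omega)) (Or.inr ⟨t, ht0, by rw [Function.update_self]; omega⟩)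
        hS (hmono' k habove' (by omega)) (hne' k (by omega))
    by_cases h1 : (t + 1, j) ∈ S
    · have ht1 : b (t + 1) = k + 2 := (hbelow (t + 1) (by omega) (hcol h1)).trans hB
      by_cases h2 : (t + 2, j) ∈ S
      -- two boxes below the last box of row `t` exclude `k` and `k + 1` from row `t`
      · have hf := tabSum_update_of_forced hS (b := b) (d := 2) (v := k) (by omega) hj' h2
          (by rw [hbelow (t + 2) (by omega) (hcol h2)]; omega)
        rwa [hf] at hQ
      · -- the boxes `(t, j)` and `(t + 1, j)` are stripped together
        have hj1 : (t + 1, j + 1) ∉ S := fun h =>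
          hj' (hS (Prod.mk_le_mk.mpr ⟨Nat.le_succ t, le_rfl⟩) h)
        have hS' : IsLowerSet (S.erase (t + 1, j) : Set (ℕ × ℕ)) := isLowerSet_erase hS hj1 h2
        have hmS' : ∀ {c}, c ≠ (t + 1, j) → (c ∈ S.erase (t + 1, j) ↔ c ∈ S) := fun h => by
          simp [h]
        have hpS' : (t, j) ∈ S.erase (t + 1, j) := (hmS' (by simp)).mpr hj
        have hp1S' : (t, j + 1) ∉ S.erase (t + 1, j) := fun h => hj' (Finset.mem_of_mem_erase h)
        have hp2S' : (t + 1, j) ∉ S.erase (t + 1, j) := Finset.notMem_erase _ _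
        have hS'' := isLowerSet_erase hS' hp1S' hp2S'
        set S' := S.erase (t + 1, j) with hS'def
        set S'' := S'.erase (t, j) with hS''def
        set b₄ := Function.update b t k with hb₄
        have e1 : tabSum S (Function.update b t (k + 1)) = tabSum S b :=
          tabSum_update_of_forced hS (d := 1) (by omega) hj' h1 (by omega)
        have e2 := tabSum_corner hS (b := Function.update b t (k + 1)) (k := k + 1) h1 hj1 h2
          (by simpa using ht1) (fun s hs => by
            obtain rfl : s = t := by omega
            rw [Function.update_self])
        have e3 := tabSum_update_of_forced hS
          (b := Function.update (Function.update b t (k + 1)) (t + 1) (k + 1)) (i := t) (d := 1)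
          (v := k) (by simp) hj' h1 (by simp)
        have hb₃ : Function.update (Function.update (Function.update b t (k + 1)) (t + 1) (k + 1))
            t k = Function.update b₄ (t + 1) (k + 1) := by
          rw [hb₄, Function.update_comm (by simp), Function.update_idem]
        rw [hb₃] at e3
        have e4 := tabSum_corner hS (b := Function.update b₄ (t + 1) (k + 1)) (k := k) h1 hj1 h2
          (by simp) (fun s hs => by
            obtain rfl : s = t := by omega
            simp [hb₄])
        rw [Function.update_idem] at e4
        have e5 := tabSum_corner hS' (b := Function.update b t (k + 1)) (k := k) hpS' hp1S' hp2S'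
          (by simp) (fun s hs => by
            rw [Function.update_of_ne (by omega)]
            exact habove' s (by omega))
        rw [Function.update_idem, ← hb₄] at e5
        have e6 : tabSum S'' (Function.update b t (k + 1)) = tabSum S'' b := by
          rcases j with _ | j
          · refine tabSum_congr hS'' fun i hi => ?_
            rw [Function.update_of_ne]
            rintro rfl
            exact Finset.notMem_erase _ _ hi
          · refine tabSum_update_of_forced hS'' (d := 1) (j := j) (by omega)
              (Finset.notMem_erase _ _) ?_ (by omega)
            refine Finset.mem_erase.mpr ⟨by simp, (hmS' (by simp)).mpr ?_⟩
            exact hS (Prod.mk_le_mk.mpr ⟨le_rfl, Nat.le_succ j⟩) h1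
        have hsub' : S' ⊆ S := Finset.erase_subset _ _
        have hnS' : ∀ S₁ ⊆ S', S₁ ≠ S := fun S₁ h₁ h => hp2S' (h₁ (h ▸ h1))
        have hmono₄ := hmono' k habove' (by omega)
        have hsymm₄ : ∀ S₁ ⊆ S', IsLowerSet (S₁ : Set (ℕ × ℕ)) →
            swapVars k (tabSum S₁ b₄) = tabSum S₁ b₄ := fun S₁ h₁ hl =>
          IH S₁ b₄ (h₁.trans hsub') (hle' k (by omega)) (Or.inl (hnS' S₁ h₁)) hl hmono₄
            (hne' k (by omega))
        have hQ' : swapVars k (tabSum S (Function.update b₄ (t + 1) k))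
            = tabSum S (Function.update b₄ (t + 1) k) := by
          refine IH S _ subset_rfl ?_ (Or.inr ⟨t, ht0, by simp [hb₄]; omega⟩) hS ?_ ?_
          · intro i
            by_cases h : i = t + 1
            · rw [h, Function.update_self]; omega
            · rw [Function.update_of_ne h]; exact hle' k (by omega) i
          · intro i i' hii hi'
            have h3 := hmono₄ i i' hii hi'
            by_cases h : i = t + 1 <;> by_cases h' : i' = t + 1
            · simp [h, h']
            · have h4 : b₄ i' = b i' := Function.update_of_ne (by omega) _ _
              rw [h, Function.update_self, Function.update_of_ne h', h4,
                hbelow i' (by omega) hi']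
              omega
            · rw [h', Function.update_self, Function.update_of_ne h]
              by_cases h'' : i = t
              · simp [hb₄, h'']
              · rw [hb₄, Function.update_of_ne h'']
                exact habove' i (by omega)
            · rwa [Function.update_of_ne h, Function.update_of_ne h']
          · intro i hi
            by_cases h : i = t + 1
            · rw [h, Function.update_self]; omega
            · rw [Function.update_of_ne h]; exact hne' k (by omega) i hi
        have hY := hsymm₄ S' subset_rfl hS'
        have hW : swapVars k (tabSum S'' b) = tabSum S'' b :=
          IH S'' b ((Finset.erase_subset _ _).trans hsub') (fun _ => le_rfl)
            (Or.inl (hnS' _ (Finset.erase_subset _ _))) hS'' hmono hne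
        have hE := swapVars_pair hS' (b := b₄) (t := t + 1) (k := k)
          (by rw [hb₄, Function.update_of_ne (by omega)]; exact ht1)
          (fun s hs => by
            obtain rfl : s = t := by omega
            simp [hb₄])
          (fun s hs hsS => by
            rw [hb₄, Function.update_of_ne (by omega), hbelow s (by omega) (hsub' hsS), hB])
          hsymm₄
        have hfinal : tabSum S b
            = (1 + beta * X k) * (1 + beta * X (k + 1)) * tabSum S (Function.update b₄ (t + 1) k)
              + (X k * (1 + beta * X (k + 1)) * tabSum S' (Function.update b₄ (t + 1) (k + 1))
                + X (k + 1) * tabSum S' b₄)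
              + beta * X k * X (k + 1) * tabSum S' b₄ + X k * X (k + 1) * tabSum S'' b := by
          rw [← e1, e2, ← e3, e4, e5, e6]
          ring
        rw [hfinal, map_add, map_add, map_add, hE]
        simp only [map_add, map_mul, map_one, swapVars_beta, swapVars_X_left, swapVars_X_right,
          hY, hW, hQ']
        ring
    -- row `t` ends in a corner: strip off `k + 1` and then `k`
    · have hS' := isLowerSet_erase hS hj' h1
      have e1 := tabSum_corner hS (k := k + 1) hj hj' h1 (ht.trans hB)
        (fun s hs => (habove' s (by omega)).trans (Nat.le_succ k))
      have e2 := tabSum_corner hS (b := Function.update b t (k + 1)) (k := k) hj hj' h1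
        (by simp) (fun s hs => by
          rw [Function.update_of_ne (by omega)]
          exact habove' s (by omega))
      rw [Function.update_idem] at e2
      have hE := swapVars_pair hS' (b := b) (t := t) (k := k) (ht.trans hB)
        (fun s hs => habove' s (by omega))
        (fun s hs hsS => (hbelow s hs.le (Finset.mem_of_mem_erase hsS)).trans hB)
        (fun S₁ h₁ hl => IH S₁ b (h₁.trans (Finset.erase_subset _ _)) (fun _ => le_rfl)
          (Or.inl fun h => Finset.notMem_erase _ _ (h₁ (h ▸ hj))) hl hmono hne)
      have hfinal : tabSum S b
          = (1 + beta * X k) * (1 + beta * X (k + 1)) * tabSum S (Function.update b t k)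
            + (X k * (1 + beta * X (k + 1))
                * tabSum (S.erase (t, j)) (Function.update b t (k + 1))
              + X (k + 1) * tabSum (S.erase (t, j)) b) := by
        rw [e1, e2]
        ring
      rw [hfinal, map_add, hE]
      simp only [map_add, map_mul, map_one, swapVars_beta, swapVars_X_left, swapVars_X_right, hQ]
      ring

/-- If row `i` is the only one whose largest entry is `k`, and ends in a corner, then `π_k` removes
that corner and raises the bound of the row. -/
theorem dividedDiff_tabSum {S : Finset (ℕ × ℕ)} (hS : IsLowerSet (S : Set (ℕ × ℕ))) {b : ℕ → ℕ}
    {i j k : ℕ} (hc : (i, j) ∈ S) (hr : (i, j + 1) ∉ S) (hd : (i + 1, j) ∉ S)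
    (hmono : ∀ s s', s ≤ s' → (s', 0) ∈ S → b s ≤ b s') (hb : b i = k + 1)
    (hup : ∀ s, s < i → b s ≤ k) (hdown : ∀ s, i < s → (s, 0) ∈ S → k + 2 ≤ b s) :
    dividedDiff k (tabSum S b)
      = tabSum (S.erase (i, j)) (Function.update b i (k + 2)) := by
  have hmono' : ∀ s s', s ≤ s' → (s', 0) ∈ S →
      Function.update b i (k + 2) s ≤ Function.update b i (k + 2) s' := by
    intro s s' hss hs'
    have h1 := hmono s s' hss hs'
    by_cases h : s = i <;> by_cases h' : s' = i
    · simp [h, h']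
    · rw [h, Function.update_self, Function.update_of_ne h']
      exact hdown s' (by omega) hs'
    · rw [h', Function.update_self, Function.update_of_ne h]
      have := hup s (by omega)
      omega
    · rwa [Function.update_of_ne h, Function.update_of_ne h']
  have hne' : ∀ s, (s, 0) ∈ S → Function.update b i (k + 2) s ≠ k + 1 := by
    intro s hs
    by_cases h : s = i
    · rw [h, Function.update_self]; omega
    · rw [Function.update_of_ne h]
      rcases Nat.lt_or_gt_of_ne h with h' | h'
      · have := hup s h'
        omega
      · have := hdown s h' hs
        omega
  have hA := swapVars_tabSum hS hmono' hne'
  have hB := swapVars_tabSum (isLowerSet_erase hS hr hd) (b := Function.update b i (k + 2))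
    (k := k) (fun s s' h h' => hmono' s s' h (Finset.mem_of_mem_erase h'))
    (fun s h => hne' s (Finset.mem_of_mem_erase h))
  have hrec := tabSum_corner hS (b := Function.update b i (k + 2)) (k := k + 1) hc hr hd
    (by simp) (fun s hs => by
      rw [Function.update_of_ne (by omega)]
      have := hup s (by omega)
      omega)
  rw [Function.update_idem, ← hb, Function.update_eq_self] at hrec
  -- `s_k` exchanges `x_k` and `x_{k+1}` in the coefficients and fixes both symmetric sums
  have hrec' := congrArg (swapVars k) hrec
  rw [hA, hb] at hrec'
  simp only [map_add, map_mul, map_one, swapVars_beta, swapVars_X_right, hB] at hrec'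
  rw [hb] at hrec
  apply mul_left_cancel₀ (X_sub_ne_zero (show k ≠ k + 1 by omega))
  rw [dividedDiff_spec]
  linear_combination hrec' - hrec

variable {n : ℕ}

/-! ### The code of a vexillary permutation -/

/-- The Lehmer code of `w`: the number of boxes in row `x` of the diagram. -/
def code (w : Equiv.Perm (Fin n)) (x : Fin n) : ℕ :=
  Finset.card {y : Fin n | x < y ∧ w y < w x}

theorem IsVexillary.false_of {w : Equiv.Perm (Fin n)} (hw : IsVexillary w) {a b c d : Fin n}
    (h1 : a < b) (h2 : b < c) (h3 : c < d) (h4 : w b < w a) (h5 : w a < w d) (h6 : w d < w c) :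
    False :=
  hw ⟨a, b, c, d, h1, h2, h3, h4, h5, h6⟩

theorem code_lt_code {w : Equiv.Perm (Fin n)} {x y : Fin n} (h : x < y) (hw : w y < w x) :
    code w y < code w x := by
  refine Finset.card_lt_card (Finset.ssubset_iff_of_subset ?_ |>.mpr ⟨y, by simp [h, hw], by simp⟩)
  intro z hz
  simp only [Finset.mem_filter, Finset.mem_univ, true_and] at hz ⊢
  exact ⟨h.trans hz.1, hz.2.trans hw⟩

theorem lt_of_code_le {w : Equiv.Perm (Fin n)} {x y : Fin n} (h : x < y)
    (hw : code w x ≤ code w y) : w x < w y := by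
  by_contra hlt
  exact absurd (code_lt_code h (lt_of_le_of_ne (not_lt.mp hlt) (by simp [h.ne']))) (by omega)

/-- If no value between the positions `x` and `p` is below `w x < w p`, then `code w x` only counts
positions after `p`. -/
theorem code_eq_card_of_forall {w : Equiv.Perm (Fin n)} {x p : Fin n} (hxp : x < p)
    (hwp : w x < w p) (h : ∀ l, x < l → l < p → w x < w l) :
    code w x = Finset.card {y : Fin n | p < y ∧ w y < w x} := by
  refine congrArg Finset.card (Finset.filter_congr fun y _ => ?_)
  constructor
  · rintro ⟨h1, h2⟩
    refine ⟨?_, h2⟩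
    rcases lt_trichotomy y p with h3 | h3 | h3
    · exact absurd (h y h1 h3) (not_lt.mpr h2.le)
    · subst h3; exact absurd h2 (not_lt.mpr hwp.le)
    · exact h3
  · exact fun ⟨h1, h2⟩ => ⟨hxp.trans h1, h2⟩

/-- In a vexillary permutation, an inversion `x < l` followed by a larger value at `p` forces all
later values below `w p` to be below `w x`. -/
theorem IsVexillary.lt_of_lt {w : Equiv.Perm (Fin n)} (hw : IsVexillary w) {x l p d : Fin n}
    (h1 : x < l) (h2 : l < p) (h3 : w l < w x) (h4 : p < d) (h5 : w d < w p) : w d < w x := by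
  by_contra h
  have : w x ≠ w d := by simp [((h1.trans h2).trans h4).ne]
  exact hw.false_of h1 h2 h4 h3 (lt_of_le_of_ne (not_lt.mp h) this) h5

theorem IsVexillary.code_eq_add {w : Equiv.Perm (Fin n)} (hw : IsVexillary w) {x l p : Fin n}
    (h1 : x < l) (h2 : l < p) (h3 : w l < w x) (h4 : w x < w p) :
    code w x = code w p + Finset.card {y : Fin n | x < y ∧ y < p ∧ w y < w x} := by
  rw [code, code, ← Finset.card_union_of_disjoint]
  · congr 1
    ext y
    simp only [Finset.mem_filter, Finset.mem_univ, true_and, Finset.mem_union]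
    constructor
    · rintro ⟨h5, h6⟩
      rcases lt_trichotomy y p with h7 | h7 | h7
      · exact Or.inr ⟨h5, h7, h6⟩
      · subst h7; exact absurd h6 (not_lt.mpr h4.le)
      · exact Or.inl ⟨h7, h6.trans h4⟩
    · rintro (⟨h5, h6⟩ | ⟨h5, h6, h7⟩)
      · exact ⟨(h1.trans h2).trans h5, hw.lt_of_lt h1 h2 h3 h5 h6⟩
      · exact ⟨h5, h7⟩
  · rw [Finset.disjoint_filter]
    rintro y - ⟨h5, -⟩ ⟨-, h6, -⟩
    exact absurd h5 (not_lt.mpr h6.le)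

theorem IsVexillary.code_lt_code_of_lt {w : Equiv.Perm (Fin n)} (hw : IsVexillary w)
    {x l p : Fin n} (h1 : x < l) (h2 : l < p) (h3 : w l < w x) (h4 : w x < w p) :
    code w p < code w x := by
  rw [hw.code_eq_add h1 h2 h3 h4]
  have : 0 < Finset.card {y : Fin n | x < y ∧ y < p ∧ w y < w x} :=
    Finset.card_pos.mpr ⟨l, by simp [h1, h2, h3]⟩
  omega

/-- In a vexillary permutation, an entry of the code that is followed by a smaller one is not
matched or exceeded later. -/
theorem IsVexillary.code_not_between {w : Equiv.Perm (Fin n)} (hw : IsVexillary w)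
    {a b c : Fin n} (hab : a < b) (hbc : b < c) (h1 : code w b < code w a)
    (h2 : code w a ≤ code w c) : False := by
  have hac : w a < w c := lt_of_code_le (hab.trans hbc) h2
  have hl : ∃ l, a < l ∧ l ≤ b ∧ w l < w a := by
    by_contra! h
    have hb : w a < w b := lt_of_le_of_ne (h b hab le_rfl) (by simp [hab.ne])
    have := code_eq_card_of_forall hab hb fun l h3 h4 =>
      lt_of_le_of_ne (h l h3 h4.le) (by simp [h3.ne])
    have h5 : Finset.card {y : Fin n | b < y ∧ w y < w a} ≤ code w b :=
      Finset.card_le_card (Finset.monotone_filter_right _ fun y _ hy => ⟨hy.1, hy.2.trans hb⟩)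
    omega
  obtain ⟨l, h3, h4, h5⟩ := hl
  have := hw.code_lt_code_of_lt h3 (h4.trans_lt hbc) h5 hac
  omega

/-! ### Choosing an ascent -/

/-- The data of the induction step: `K, K'` are adjacent positions with `w K < w K'`, the largest
value of the code at the right end of an ascent is `code w K'`, and no ascent further left has
it. -/
structure IsTopAscent (w : Equiv.Perm (Fin n)) (K K' : Fin n) : Prop where
  succ : (K' : ℕ) = K + 1
  ascent : w K < w K'
  code_le : ∀ J J' : Fin n, (J' : ℕ) = J + 1 → w J < w J' → code w J' ≤ code w K'
  first : ∀ J J' : Fin n, (J' : ℕ) = J + 1 → w J < w J' → code w J' = code w K' → K ≤ J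

theorem exists_isTopAscent {w : Equiv.Perm (Fin n)} (hw : w ≠ Fin.revPerm) :
    ∃ K K', IsTopAscent w K K' := by
  obtain ⟨i, hi⟩ := exists_ascent hw
  obtain ⟨hin, hiw⟩ := (ascent_iff w i).mp hi
  -- the ascents, as pairs of adjacent positions
  let A : Finset (Fin n × Fin n) := {c | (c.2 : ℕ) = c.1 + 1 ∧ w c.1 < w c.2}
  have hA : ∀ c, c ∈ A ↔ (c.2 : ℕ) = c.1 + 1 ∧ w c.1 < w c.2 := fun c => by simp [A]
  obtain ⟨c, hc, hcmax⟩ := A.exists_max_image (fun c => code w c.2)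
    ⟨(⟨i, by omega⟩, ⟨i + 1, hin⟩), by simpa [A] using hiw⟩
  obtain ⟨e, he, hemin⟩ := (A.filter fun e => code w e.2 = code w c.2).exists_min_image
    (fun e => e.1) ⟨c, by simp [hc]⟩
  rw [Finset.mem_filter, hA] at he
  refine ⟨e.1, e.2, he.1.1, he.1.2, fun J J' h1 h2 => ?_, fun J J' h1 h2 h3 => ?_⟩
  · rw [he.2]
    exact hcmax (J, J') ((hA _).mpr ⟨h1, h2⟩)
  · exact hemin (J, J') (Finset.mem_filter.mpr ⟨(hA _).mpr ⟨h1, h2⟩, h3.trans he.2⟩)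

namespace IsTopAscent

variable {w : Equiv.Perm (Fin n)} {K K' : Fin n}

theorem lt (h : IsTopAscent w K K') : K < K' := by
  have := h.succ
  exact Fin.lt_def.mpr (by omega)

theorem le_of_lt (h : IsTopAscent w K K') {y : Fin n} (hy : y < K') : y ≤ K := by
  have := h.succ
  rw [Fin.lt_def] at hy
  exact Fin.le_def.mpr (by omega)

theorem le_of_gt (h : IsTopAscent w K K') {y : Fin n} (hy : K < y) : K' ≤ y := by
  have := h.succ
  rw [Fin.lt_def] at hy
  exact Fin.le_def.mpr (by omega)

theorem code_eq (h : IsTopAscent w K K') :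
    code w K = Finset.card {y : Fin n | K' < y ∧ w y < w K} :=
  code_eq_card_of_forall h.lt h.ascent fun _ h1 h2 => absurd (h.le_of_lt h2) (not_le.mpr h1)

theorem code_le' (h : IsTopAscent w K K') : code w K ≤ code w K' := by
  rw [h.code_eq]
  exact Finset.card_le_card (Finset.monotone_filter_right _ fun y _ hy =>
    ⟨hy.1, hy.2.trans h.ascent⟩)

/-- The positions with code above `code w K'` form an initial segment on which `w` decreases. -/
theorem initial (h : IsTopAscent w K K') {x : Fin n} (hx : code w K' < code w x) {y : Fin n}
    (hy : y < x) : w x < w y := by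
  have hall : ∀ d : ℕ, ∀ y x : Fin n, (x : ℕ) = y + (d + 1) → code w K' < code w x →
      w x < w y := by
    intro d
    induction d with
    | zero =>
      intro y x hyx hx
      by_contra hlt
      have hlt' : w y < w x := lt_of_le_of_ne (not_lt.mp hlt) (by simp [Fin.ext_iff]; omega)
      exact absurd (h.code_le y x hyx hlt') (by omega)
    | succ d ih =>
      intro y x hyx hx
      let z : Fin n := ⟨y + 1, by omega⟩
      have h1 := ih z x (by simp [z]; omega) hx
      have h2 := code_lt_code (w := w) (x := z) (y := x) (Fin.lt_def.mpr (by simp [z]; omega)) h1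
      refine h1.trans ?_
      by_contra hlt
      have hlt' : w y < w z :=
        lt_of_le_of_ne (not_lt.mp hlt) (by simp only [ne_eq, EmbeddingLike.apply_eq_iff_eq, Fin.ext_iff, z]; omega)
      exact absurd (h.code_le y z rfl hlt') (by omega)
  rw [Fin.lt_def] at hy
  exact hall (x - y - 1) y x (by omega) hx

theorem code_gt (h : IsTopAscent w K K') {x : Fin n} (hx : code w K' < code w x) {y : Fin n}
    (hy : y ≤ x) : code w K' < code w y := by
  rcases hy.lt_or_eq with hy | rfl
  · exact hx.trans (code_lt_code hy (h.initial hx hy))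
  · exact hx

theorem lt_of_code_gt (h : IsTopAscent w K K') {x : Fin n} (hx : code w K' < code w x) :
    x < K := by
  by_contra hlt
  have := h.code_gt hx (not_lt.mp hlt)
  have := h.code_le'
  omega

theorem code_eq_of_le (h : IsTopAscent w K K') (hw : IsVexillary w) {x z : Fin n}
    (hz : code w z = code w K') (hx : K' ≤ x) (hxz : x ≤ z) : code w x = code w K' := by
  apply le_antisymm
  · by_contra! hlt
    exact absurd (h.lt_of_code_gt hlt) (not_lt.mpr (h.lt.le.trans hx))
  · by_contra! hlt
    rcases hx.lt_or_eq with h1 | rfl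
    · rcases hxz.lt_or_eq with h2 | rfl
      · exact hw.code_not_between h1 h2 hlt hz.ge
      · omega
    · omega

/-- If the value `code w K' + 1` occurs in the code, it occurs at the position before `K`. -/
theorem succ_eq_of_code_eq (h : IsTopAscent w K K') (hw : IsVexillary w) {x : Fin n}
    (hx : code w x = code w K' + 1) : (x : ℕ) + 1 = K := by
  have hxK := h.lt_of_code_gt (x := x) (by omega)
  rw [Fin.lt_def] at hxK
  by_contra hne
  let y : Fin n := ⟨x + 1, by omega⟩
  let z : Fin n := ⟨x + 2, by omega⟩
  have hxy : x < y := Fin.lt_def.mpr (by simp [y])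
  have hyz : y < z := Fin.lt_def.mpr (by simp [y, z])
  have hyK : y < K := Fin.lt_def.mpr (by simp [y]; omega)
  have hy : code w y ≤ code w K' := by
    by_contra! hlt
    have := code_lt_code hxy (h.initial hlt hxy)
    omega
  have hwy : w y < w x := by
    by_contra hlt
    have := h.code_le x y rfl (lt_of_le_of_ne (not_lt.mp hlt) (by simp [hxy.ne]))
    have h2 : code w x ≤ code w y := by
      rw [code_eq_card_of_forall hxy (lt_of_le_of_ne (not_lt.mp hlt) (by simp [hxy.ne]))]
      · exact Finset.card_le_card (Finset.monotone_filter_right _ fun l _ hl =>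
          ⟨hl.1, hl.2.trans_le (not_lt.mp hlt)⟩)
      · intro l h1 h2
        simp only [Fin.lt_def, y] at h1 h2
        omega
    omega
  by_cases hxK' : w x < w K'
  · have hadd := hw.code_eq_add hxy (hyK.trans h.lt) hwy hxK'
    have hone : Finset.card {l : Fin n | x < l ∧ l < K' ∧ w l < w x} = 1 := by omega
    obtain ⟨l₀, hl₀⟩ := Finset.card_eq_one.mp hone
    have hall : ∀ l, x < l → l < K' → w l < w x → l = l₀ := fun l h1 h2 h3 => by
      have : l ∈ ({l₀} : Finset (Fin n)) := hl₀ ▸ (by simp [h1, h2, h3])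
      simpa using this
    have hzK : z ≤ K := Fin.le_def.mpr (by simp [z]; omega)
    have hzK' : z < K' := hzK.trans_lt h.lt
    have hwz : w x < w z := by
      by_contra hlt
      have h1 := hall z (hxy.trans hyz) hzK'
        (lt_of_le_of_ne (not_lt.mp hlt) (by simp [(hxy.trans hyz).ne']))
      have h2 := hall y hxy (hyK.trans h.lt) hwy
      exact hyz.ne (h2.trans h1.symm)
    have hz1 : code w K' ≤ code w z :=
      Finset.card_le_card fun d hd => by
        simp only [Finset.mem_filter, Finset.mem_univ, true_and] at hd ⊢
        exact ⟨hzK'.trans hd.1,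
          (hw.lt_of_lt hxy (hyK.trans h.lt) hwy hd.1 hd.2).trans hwz⟩
    have hasc : w y < w z := hwy.trans hwz
    have := h.first y z rfl hasc (le_antisymm (h.code_le y z rfl hasc) hz1)
    exact absurd hyK (not_lt.mpr this)
  · have hwK' : w K' < w x :=
      lt_of_le_of_ne (not_lt.mp hxK') (by simp [((hxy.trans hyK).trans h.lt).ne'])
    have hsub : insert y (insert K' ({d : Fin n | K' < d ∧ w d < w K'} : Finset (Fin n)))
        ⊆ ({d : Fin n | x < d ∧ w d < w x} : Finset (Fin n)) := by
      intro d hd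
      simp only [Finset.mem_insert, Finset.mem_filter, Finset.mem_univ, true_and] at hd ⊢
      rcases hd with rfl | rfl | hd
      · exact ⟨hxy, hwy⟩
      · exact ⟨(hxy.trans hyK).trans h.lt, hwK'⟩
      · exact ⟨((hxy.trans hyK).trans h.lt).trans hd.1, hd.2.trans hwK'⟩
    have hcard := Finset.card_le_card hsub
    rw [Finset.card_insert_of_notMem, Finset.card_insert_of_notMem (by simp)] at hcard
    · change code w K' + 1 + 1 ≤ code w x at hcard
      omega
    · have := hyK.trans h.lt
      simp [this.ne, not_lt.mpr this.le]

/-- Exchanging the values at `K` and `K'` creates no pattern 2143: the two positions would have to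
play the part of `21` or of `43`. -/
theorem swap_vexillary (h : IsTopAscent w K K') (hw : IsVexillary w) :
    IsVexillary (w * Equiv.swap K K') := by
  have hK : (w * Equiv.swap K K') K = w K' := by simp
  have hK' : (w * Equiv.swap K K') K' = w K := by simp
  have hne : ∀ x, x ≠ K → x ≠ K' → (w * Equiv.swap K K') x = w x := fun x h1 h2 => by
    simp [Equiv.swap_apply_of_ne_of_ne h1 h2]
  have hKK' := h.lt
  have hsc := h.succ
  rintro ⟨a, b, c, d, hab, hbc, hcd, h1, h2, h3⟩
  -- the positions of the pattern after exchanging `K` and `K'`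
  have hmono : ∀ x y : Fin n, x < y → ¬ (x = K ∧ y = K') →
      Equiv.swap K K' x < Equiv.swap K K' y := by
    intro x y hxy hn
    simp only [Equiv.swap_apply_def, Fin.ext_iff, Fin.lt_def] at *
    split_ifs <;> omega
  by_cases e1 : a = K ∧ b = K'
  · obtain ⟨rfl, rfl⟩ := e1
    have hac := hab.trans hbc
    rw [hK] at h1 h2
    rw [hne d (hac.trans hcd).ne' (hbc.trans hcd).ne'] at h2 h3
    rw [hne c hac.ne' hbc.ne'] at h3
    have hcle : code w c ≤ code w b := by
      by_contra! hlt
      exact absurd (h.lt_of_code_gt hlt) (not_lt.mpr hac.le)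
    -- some value between `b` and `c` is below `w b`
    have hl : ∃ l, b < l ∧ l < c ∧ w l < w b := by
      by_contra! hcon
      have h4 := code_eq_card_of_forall hbc (h2.trans h3) fun l h5 h6 =>
        lt_of_le_of_ne (hcon l h5 h6) (by simp [h5.ne])
      have h5 : Finset.card {y : Fin n | c < y ∧ w y < w b} < code w c := by
        refine Finset.card_lt_card
          (Finset.ssubset_iff_of_subset ?_ |>.mpr ⟨d, by simp [hcd, h3], by simp [h2.le]⟩)
        exact Finset.monotone_filter_right _ fun y _ hy => ⟨hy.1, hy.2.trans (h2.trans h3)⟩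
      omega
    obtain ⟨l, h4, h5, h6⟩ := hl
    exact hw.false_of h4 h5 hcd h6 h2 h3
  by_cases e2 : c = K ∧ d = K'
  · obtain ⟨rfl, rfl⟩ := e2
    have hac := hab.trans hbc
    rw [hne a hac.ne (hac.trans hcd).ne] at h1 h2
    rw [hne b hbc.ne (hbc.trans hcd).ne] at h1
    rw [hK'] at h2
    -- both `c` and `d` have code equal to the number of later values below `w a`
    have hlt : code w d < code w a := hw.code_lt_code_of_lt hab (hbc.trans hcd) h1
      (h2.trans h.ascent)
    have hcd' : code w c = code w d := by
      rw [h.code_eq]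
      refine congrArg Finset.card (Finset.filter_congr fun y _ => ⟨fun hy =>
        ⟨hy.1, hy.2.trans h.ascent⟩, fun hy => ⟨hy.1, ?_⟩⟩)
      exact (hw.lt_of_lt hab (hbc.trans hcd) h1 hy.1 hy.2).trans h2
    have hc0 : (a : ℕ) < c := Fin.lt_def.mp hac
    let J : Fin n := ⟨c - 1, by omega⟩
    have hJ : (c : ℕ) = J + 1 := by simp [J]; omega
    have haJ : a ≤ J := Fin.le_def.mpr (by omega)
    by_cases h4 : w J < w c
    · have := h.first J c hJ h4 hcd'
      rw [Fin.le_def] at this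
      omega
    · have h5 : w c < w J := lt_of_le_of_ne (not_lt.mp h4)
        (by simp only [ne_eq, EmbeddingLike.apply_eq_iff_eq, Fin.ext_iff]; omega)
      have h6 := code_lt_code (w := w) (x := J) (y := c) (Fin.lt_def.mpr (by omega)) h5
      rcases haJ.lt_or_eq with h7 | h7
      · exact absurd ((h5.trans (h.initial (by omega) h7)).trans h2) (lt_irrefl _)
      · rw [h7] at h2
        exact absurd (h5.trans h2) (lt_irrefl _)
  by_cases e3 : b = K ∧ c = K'
  · obtain ⟨rfl, rfl⟩ := e3
    rw [hK] at h1
    rw [hne a hab.ne (hab.trans hbc).ne] at h1 h2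
    rw [hne d (hbc.trans hcd).ne' hcd.ne'] at h2 h3
    rw [hK'] at h3
    exact absurd ((h1.trans h2).trans (h3.trans h.ascent)) (lt_irrefl _)
  exact hw ⟨_, _, _, _, hmono a b hab e1, hmono b c hbc e3, hmono c d hcd e2, h1, h2, h3⟩

end IsTopAscent

/-! ### The code of `w s_K` -/

theorem code_mul_swap {w : Equiv.Perm (Fin n)} {K K' : Fin n} (hsc : (K' : ℕ) = K + 1)
    (hw : w K < w K') (x : Fin n) :
    code (w * Equiv.swap K K') x
      = code w (Equiv.swap K K' x) + if x = K then 1 else 0 := by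
  have hlt : K < K' := Fin.lt_def.mpr (by omega)
  by_cases h1 : x = K
  · subst h1
    rw [if_pos rfl, Equiv.swap_apply_left]
    have : ({y : Fin n | x < y ∧ (w * Equiv.swap x K') y < (w * Equiv.swap x K') x} : Finset _)
        = insert K' ({y : Fin n | K' < y ∧ w y < w K'} : Finset _) := by
      ext y
      simp only [Finset.mem_filter, Finset.mem_univ, true_and, Finset.mem_insert,
        Equiv.Perm.mul_apply, Equiv.swap_apply_left]
      by_cases h2 : y = K'
      · subst h2; simp [hlt, hw]
      · by_cases h3 : y = x
        · subst h3; simp [h2, not_lt.mpr hlt.le]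
        · rw [Equiv.swap_apply_of_ne_of_ne h3 h2]
          simp only [Fin.lt_def, Fin.ext_iff] at *
          omega
    rw [code, this, Finset.card_insert_of_notMem (by simp), code]
  · rw [if_neg h1, add_zero]
    by_cases h2 : x = K'
    · subst h2
      rw [Equiv.swap_apply_right, code, code]
      refine congrArg Finset.card (Finset.filter_congr fun y _ => ?_)
      rw [Equiv.Perm.mul_apply, Equiv.Perm.mul_apply, Equiv.swap_apply_right]
      by_cases h3 : y = K
      · subst h3; simp [not_lt.mpr hlt.le]
      · by_cases h4 : y = x
        · subst h4; simp [hw.le]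
        · rw [Equiv.swap_apply_of_ne_of_ne h3 h4]
          simp only [Fin.lt_def, Fin.ext_iff] at *
          omega
    · have hx : (w * Equiv.swap K K') x = w x := by
        rw [Equiv.Perm.mul_apply, Equiv.swap_apply_of_ne_of_ne h1 h2]
      have hiff : ∀ y, x < Equiv.swap K K' y ↔ x < y := fun y => by
        simp only [Equiv.swap_apply_def, Fin.ext_iff, Fin.lt_def] at *
        split_ifs <;> omega
      rw [Equiv.swap_apply_of_ne_of_ne h1 h2, code, code]
      refine Finset.card_bij' (fun y _ => Equiv.swap K K' y) (fun y _ => Equiv.swap K K' y)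
        ?_ ?_ (by simp) (by simp)
      · intro y hy
        rw [Finset.mem_filter, hx] at hy
        rw [Finset.mem_filter, hiff]
        exact ⟨Finset.mem_univ _, hy.2⟩
      · intro y hy
        rw [Finset.mem_filter] at hy
        rw [Finset.mem_filter, hiff, hx, Equiv.Perm.mul_apply, Equiv.swap_apply_self]
        exact ⟨Finset.mem_univ _, hy.2⟩

/-! ### The shape and the row bounds given by the code -/

theorem code_lt (w : Equiv.Perm (Fin n)) (x : Fin n) : code w x < n := by
  have : code w x < (Finset.univ : Finset (Fin n)).card :=
    Finset.card_lt_card (Finset.ssubset_univ_iff.mpr fun h => by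
      have := (Finset.ext_iff.mp h x).mpr (Finset.mem_univ x)
      simp at this)
  simpa using this

/-- The length of the `j`-th column of the partition obtained by sorting the code. -/
def colHeight (w : Equiv.Perm (Fin n)) (j : ℕ) : ℕ := Finset.card {x : Fin n | j < code w x}

theorem colHeight_anti (w : Equiv.Perm (Fin n)) : Antitone (colHeight w) := fun _ _ h =>
  Finset.card_le_card (Finset.monotone_filter_right _ fun _ _ hx => h.trans_lt hx)

theorem colHeight_le (w : Equiv.Perm (Fin n)) (j : ℕ) : colHeight w j ≤ n :=
  (Finset.card_le_univ _).trans (by simp)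

theorem colHeight_lt_of_code_eq {w : Equiv.Perm (Fin n)} {x : Fin n} {j m : ℕ} (hj : j < m)
    (hx : code w x = m) : colHeight w m < colHeight w j := by
  refine Finset.card_lt_card
    (Finset.ssubset_iff_of_subset ?_ |>.mpr ⟨x, by simp [hx, hj], by simp [hx]⟩)
  exact Finset.monotone_filter_right _ fun _ _ hy => hj.trans hy

theorem exists_code_eq {w : Equiv.Perm (Fin n)} {j : ℕ}
    (h : colHeight w (j + 1) < colHeight w j) : ∃ x, code w x = j + 1 := by
  by_contra! hcon
  refine absurd h (not_lt.mpr (Finset.card_le_card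
    (Finset.monotone_filter_right _ fun x _ hx => ?_)))
  have := hcon x
  change j < code w x at hx
  change j + 1 < code w x
  omega

theorem colHeight_eq_add (w : Equiv.Perm (Fin n)) (j : ℕ) :
    colHeight w j = colHeight w (j + 1) + Finset.card {x : Fin n | code w x = j + 1} := by
  rw [colHeight, colHeight, ← Finset.card_union_of_disjoint]
  · congr 1
    ext x
    simp only [Finset.mem_filter, Finset.mem_univ, true_and, Finset.mem_union]
    omega
  · rw [Finset.disjoint_filter]
    intro x _ h
    omega

/-- The partition obtained by sorting the code of `w`. -/
def codeShape (w : Equiv.Perm (Fin n)) : YoungDiagram where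
  cells := (Finset.range n ×ˢ Finset.range n).filter fun c => c.1 < colHeight w c.2
  isLowerSet := by
    rintro ⟨p, q⟩ ⟨p', q'⟩ hle hc
    obtain ⟨h1, h2⟩ := Prod.mk_le_mk.mp hle
    simp only [Finset.coe_filter, Finset.mem_product, Finset.mem_range, Set.mem_ofPred_eq] at hc ⊢
    have := colHeight_anti w h2
    omega

theorem mem_codeShape {w : Equiv.Perm (Fin n)} {i j : ℕ} :
    (i, j) ∈ (codeShape w).cells ↔ i < colHeight w j := by
  simp only [codeShape, Finset.mem_filter, Finset.mem_product, Finset.mem_range]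
  refine ⟨fun h => h.2, fun h => ⟨⟨h.trans_le (colHeight_le w j), ?_⟩, h⟩⟩
  obtain ⟨x, hx⟩ := Finset.card_pos.mp (Nat.zero_lt_of_lt h)
  have h1 := code_lt w x
  have h2 : j < code w x := by simpa using hx
  omega

theorem rowLen_codeShape {w : Equiv.Perm (Fin n)} {i j : ℕ} (h1 : i < colHeight w j)
    (h2 : colHeight w (j + 1) ≤ i) : (codeShape w).rowLen i = j + 1 := by
  have h3 := (YoungDiagram.mem_iff_lt_rowLen (μ := codeShape w)).mp (mem_codeShape.mpr h1)
  have h4 : ¬ j + 1 < (codeShape w).rowLen i := fun h =>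
    absurd (mem_codeShape.mp (YoungDiagram.mem_iff_lt_rowLen.mpr h)) (not_lt.mpr h2)
  omega

/-- One more than the last position whose code exceeds `j`. -/
def colBound (w : Equiv.Perm (Fin n)) (j : ℕ) : ℕ :=
  ({x : Fin n | j < code w x} : Finset (Fin n)).sup fun x => (x : ℕ) + 1

theorem colBound_le {w : Equiv.Perm (Fin n)} {j p : ℕ}
    (h : ∀ x, j < code w x → (x : ℕ) + 1 ≤ p) : colBound w j ≤ p :=
  Finset.sup_le fun x hx => h x (by simpa using hx)

theorem lt_colBound {w : Equiv.Perm (Fin n)} {j : ℕ} {x : Fin n} (h : j < code w x) :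
    (x : ℕ) + 1 ≤ colBound w j :=
  Finset.le_sup (f := fun x : Fin n => (x : ℕ) + 1) (by simpa using h)

theorem colBound_anti (w : Equiv.Perm (Fin n)) : Antitone (colBound w) := fun _ _ h =>
  colBound_le fun _ hx => lt_colBound (h.trans_lt hx)

/-- Row bounds for the shape of `w`: at each corner `(i, j)` the bound is `colBound w j`, and the
rows above in the same block are not bounded more than the corner forces. -/
structure IsRowBound (w : Equiv.Perm (Fin n)) (b : ℕ → ℕ) : Prop where
  corner_le : ∀ i j, i + 1 = colHeight w j → colHeight w (j + 1) ≤ i → b i ≤ colBound w j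
  le_add : ∀ i d j, i + d + 1 = colHeight w j → colHeight w (j + 1) ≤ i → colBound w j ≤ b i + d

theorem IsRowBound.tabSum_eq {w : Equiv.Perm (Fin n)} {b b' : ℕ → ℕ} (h : IsRowBound w b)
    (h' : IsRowBound w b') :
    tabSum (codeShape w).cells b = tabSum (codeShape w).cells b' := by
  have key : ∀ b b', IsRowBound w b → IsRowBound w b' →
      tableaux (codeShape w).cells b ⊆ tableaux (codeShape w).cells b' := by
    intro b b' h h'
    refine tableaux_subset (codeShape w).isLowerSet fun i j hc => ?_
    obtain ⟨l, hl, hl'⟩ := exists_last_col (i := i) (S := (codeShape w).cells)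
      ((codeShape w).isLowerSet (Prod.mk_le_mk.mpr ⟨le_rfl, Nat.zero_le j⟩) hc)
    have hjl : j ≤ l := by
      by_contra hlt
      exact hl' ((codeShape w).isLowerSet (Prod.mk_le_mk.mpr ⟨le_rfl, by omega⟩) hc)
    rw [mem_codeShape] at hl hl'
    have h1 := h.corner_le (colHeight w l - 1) l (by omega) (by omega)
    have h2 := h'.le_add i (colHeight w l - 1 - i) l (by omega) (by omega)
    have h3 : i + (colHeight w l - 1 - i) = colHeight w l - 1 := by omega
    refine ⟨colHeight w l - 1 - i, l, hjl, mem_codeShape.mpr (by omega), ?_⟩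
    rw [h3]
    exact h1.trans h2
  rw [tabSum, tabSum, (key b b' h h').antisymm (key b' b h' h)]

/-- The row bound read off from the last box of each row. -/
def lastBound (w : Equiv.Perm (Fin n)) (i : ℕ) : ℕ := colBound w ((codeShape w).rowLen i - 1)

theorem lastBound_eq {w : Equiv.Perm (Fin n)} {i j : ℕ} (h1 : i < colHeight w j)
    (h2 : colHeight w (j + 1) ≤ i) : lastBound w i = colBound w j := by
  rw [lastBound, rowLen_codeShape h1 h2, Nat.add_sub_cancel]

theorem lastBound_mono (w : Equiv.Perm (Fin n)) : Monotone (lastBound w) := fun i i' h =>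
  colBound_anti w (Nat.sub_le_sub_right ((codeShape w).rowLen_anti i i' h) 1)

/-! ### The longest element -/

theorem tabSum_eq_prod {S : Finset (ℕ × ℕ)} (hS : IsLowerSet (S : Set (ℕ × ℕ))) {b : ℕ → ℕ}
    (hb : ∀ i, (i, 0) ∈ S → b i = i + 1) : tabSum S b = ∏ c ∈ S, X c.1 := by
  induction hN : S.card generalizing S with
  | zero =>
    rw [Finset.card_eq_zero] at hN
    subst hN
    rw [tabSum_empty, Finset.prod_empty]
  | succ N ih =>
    obtain ⟨⟨i₀, j₀⟩, hc₀⟩ := Finset.card_pos.mp (show 0 < S.card by omega)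
    obtain ⟨i, -, hi, hmax⟩ := exists_last_row (i := i₀) (j := 0) (S := S)
      (hS (Prod.mk_le_mk.mpr ⟨le_rfl, Nat.zero_le _⟩) hc₀)
    obtain ⟨j, hj, hj'⟩ := exists_last_col hi
    have hd : (i + 1, j) ∉ S := fun h => by
      have := hmax (i + 1) (hS (Prod.mk_le_mk.mpr ⟨le_rfl, Nat.zero_le _⟩) h)
      omega
    rw [tabSum_corner hS hj hj' hd (hb i hi) (fun t ht => by
      rw [hb t (hS (Prod.mk_le_mk.mpr ⟨by omega, le_rfl⟩) hi)]
      omega)]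
    rw [tabSum_eq_zero hS hi (by rw [Function.update_self]), mul_zero, zero_add,
      ih (isLowerSet_erase hS hj' hd) (fun i h => hb i (Finset.mem_of_mem_erase h))
        (by rw [Finset.card_erase_of_mem hj]; omega)]
    rw [← Finset.mul_prod_erase S (fun c => (X c.1 : Poly)) hj]

theorem code_revPerm (x : Fin n) : code (Fin.revPerm : Equiv.Perm (Fin n)) x = n - 1 - x := by
  rw [code, ← Fin.card_Ioi]
  congr 1
  ext y
  simp

theorem colHeight_revPerm (j : ℕ) : colHeight (Fin.revPerm : Equiv.Perm (Fin n)) j = n - 1 - j := by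
  rw [colHeight, ← Finset.card_range (n - 1 - j)]
  refine Finset.card_bij (fun x _ => (x : ℕ)) ?_ ?_ ?_
  · intro x hx
    simp only [code_revPerm, Finset.mem_filter, Finset.mem_univ, true_and] at hx
    rw [Finset.mem_range]
    omega
  · intro x _ y _ h
    exact Fin.ext h
  · intro i hi
    rw [Finset.mem_range] at hi
    exact ⟨⟨i, by omega⟩, by simp [code_revPerm]; omega, rfl⟩

theorem grothendieck_revPerm_eq {b : ℕ → ℕ}
    (hb : IsRowBound (Fin.revPerm : Equiv.Perm (Fin n)) b) :
    grothendieck (Fin.revPerm : Equiv.Perm (Fin n))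
      = tabSum (codeShape (Fin.revPerm : Equiv.Perm (Fin n))).cells b := by
  have hb' : ∀ i, (i, 0) ∈ (codeShape (Fin.revPerm : Equiv.Perm (Fin n))).cells →
      b i = i + 1 := by
    intro i hi
    rw [mem_codeShape, colHeight_revPerm] at hi
    have hbd : colBound (Fin.revPerm : Equiv.Perm (Fin n)) (n - 2 - i) = i + 1 := by
      apply le_antisymm
      · refine colBound_le fun x hx => ?_
        rw [code_revPerm] at hx
        omega
      · exact lt_colBound (x := ⟨i, by omega⟩) (by rw [code_revPerm]; simp; omega)
    apply le_antisymm
    · rw [← hbd]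
      exact hb.corner_le i _ (by rw [colHeight_revPerm]; omega) (by rw [colHeight_revPerm]; omega)
    · rw [← hbd]
      exact hb.le_add i 0 _ (by rw [colHeight_revPerm]; omega) (by rw [colHeight_revPerm]; omega)
  rw [grothendieck_revPerm, tabSum_eq_prod (codeShape _).isLowerSet hb', codeShape]
  simp only [Finset.prod_filter, Finset.prod_product]
  rw [Finset.prod_range]
  refine Finset.prod_congr rfl fun i _ => ?_
  rw [← Finset.prod_filter, Finset.prod_const]
  congr 1
  rw [← Finset.card_range (n - 1 - i)]
  congr 1
  ext j
  simp only [Finset.mem_range, Finset.mem_filter, colHeight_revPerm]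
  omega

/-! ### Descending along top ascents -/

namespace IsTopAscent

variable {w : Equiv.Perm (Fin n)} {K K' : Fin n}

theorem colHeight_swap (h : IsTopAscent w K K') (j : ℕ) :
    colHeight (w * Equiv.swap K K') j
      = colHeight w j + if j = code w K' then 1 else 0 := by
  have h1 : colHeight (w * Equiv.swap K K') j
      = Finset.card {x : Fin n | j < code w x + if x = K' then 1 else 0} := by
    refine Finset.card_bij' (fun y _ => Equiv.swap K K' y) (fun y _ => Equiv.swap K K' y)
      ?_ ?_ (by simp) (by simp)
    · intro y hy
      simp only [Finset.mem_filter, Finset.mem_univ, true_and, code_mul_swap h.succ h.ascent]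
        at hy ⊢
      have : Equiv.swap K K' y = K' ↔ y = K := by
        rw [Equiv.swap_apply_eq_iff, Equiv.swap_apply_right]
      simpa [this] using hy
    · intro y hy
      simp only [Finset.mem_filter, Finset.mem_univ, true_and, code_mul_swap h.succ h.ascent]
        at hy ⊢
      have : Equiv.swap K K' y = K ↔ y = K' := by
        rw [Equiv.swap_apply_eq_iff, Equiv.swap_apply_left]
      simpa [this] using hy
  rw [h1, colHeight]
  by_cases hj : j = code w K'
  · rw [if_pos hj, ← Finset.card_insert_of_notMem (a := K') (by simp [hj])]
    congr 1
    ext x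
    simp only [Finset.mem_filter, Finset.mem_univ, true_and, Finset.mem_insert]
    by_cases hx : x = K'
    · simp [hx, hj]
    · simp [hx]
  · rw [if_neg hj, add_zero]
    congr 1
    ext x
    simp only [Finset.mem_filter, Finset.mem_univ, true_and]
    by_cases hx : x = K'
    · simp [hx]; omega
    · simp [hx]

theorem mem_swap (h : IsTopAscent w K K') : (colHeight w (code w K'), code w K') ∈
    (codeShape (w * Equiv.swap K K')).cells := by
  rw [mem_codeShape, h.colHeight_swap, if_pos rfl]
  omega

theorem erase_codeShape_swap (h : IsTopAscent w K K') :
    (codeShape (w * Equiv.swap K K')).cells.erase (colHeight w (code w K'), code w K')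
      = (codeShape w).cells := by
  ext ⟨i, j⟩
  rw [Finset.mem_erase, mem_codeShape, mem_codeShape, h.colHeight_swap]
  simp only [ne_eq, Prod.mk.injEq]
  by_cases hj : j = code w K'
  · subst hj
    simp only [and_true, if_true]
    omega
  · simp [hj]

theorem colBound_swap_of_gt (h : IsTopAscent w K K') {j : ℕ} (hj : code w K' < j) :
    colBound (w * Equiv.swap K K') j = colBound w j := by
  rw [colBound, colBound]
  congr 1
  ext x
  simp only [Finset.mem_filter, Finset.mem_univ, true_and, code_mul_swap h.succ h.ascent]
  have := h.code_le'
  by_cases hx : x = K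
  · subst hx; simp; omega
  · by_cases hx' : x = K'
    · subst hx'; simp [hx]; omega
    · rw [Equiv.swap_apply_of_ne_of_ne hx hx', if_neg hx, add_zero]

theorem colBound_swap_self (h : IsTopAscent w K K') :
    colBound (w * Equiv.swap K K') (code w K') = K + 1 := by
  apply le_antisymm
  · refine colBound_le fun x hx => ?_
    rw [code_mul_swap h.succ h.ascent] at hx
    by_cases hxK : x = K
    · rw [hxK]
    · by_cases hx' : x = K'
      · subst hx'
        rw [Equiv.swap_apply_right, if_neg hxK] at hx
        have := h.code_le'
        omega
      · rw [Equiv.swap_apply_of_ne_of_ne hxK hx', if_neg hxK, add_zero] at hx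
        have := Fin.lt_def.mp (h.lt_of_code_gt hx)
        omega
  · exact lt_colBound (by rw [code_mul_swap h.succ h.ascent]; simp)

/-- Exchanging the values at `K` and `K'` does not affect the bound of a row whose length occurs in
the code at a position other than `K'`. -/
theorem colBound_swap_of_lt (h : IsTopAscent w K K') (hw : IsVexillary w) {j : ℕ}
    (hj : j < code w K') {x : Fin n} (hx : x ≠ K') (hxj : code w x = j + 1) :
    colBound (w * Equiv.swap K K') j = colBound w j := by
  have hlt := h.lt
  apply le_antisymm
  · refine colBound_le fun y hy => ?_
    rw [code_mul_swap h.succ h.ascent] at hy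
    by_cases hyK : y = K
    · have := lt_colBound (w := w) (x := K') hj
      have := h.succ
      rw [hyK]
      omega
    · by_cases hyK' : y = K'
      · rw [hyK']
        exact lt_colBound hj
      · rw [Equiv.swap_apply_of_ne_of_ne hyK hyK', if_neg hyK, add_zero] at hy
        exact lt_colBound hy
  · -- a position at or after `K'` whose code in `w s_K` exceeds `j`
    have hex : ∃ z, K' ≤ z ∧ j < code (w * Equiv.swap K K') z := by
      rcases lt_trichotomy x K with h1 | h1 | h1
      · refine ⟨K', le_rfl, ?_⟩
        rw [code_mul_swap h.succ h.ascent, Equiv.swap_apply_right, if_neg hlt.ne', add_zero]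
        by_contra! hcon
        exact hw.code_not_between h1 hlt (by omega) (by omega)
      · refine ⟨K', le_rfl, ?_⟩
        rw [code_mul_swap h.succ h.ascent, Equiv.swap_apply_right, if_neg hlt.ne', add_zero, ← h1]
        omega
      · refine ⟨x, h.le_of_gt h1, ?_⟩
        rw [code_mul_swap h.succ h.ascent, Equiv.swap_apply_of_ne_of_ne h1.ne' hx, if_neg h1.ne']
        omega
    obtain ⟨z, hz, hjz⟩ := hex
    refine colBound_le fun y hy => ?_
    by_cases hyK : y ≤ K'
    · exact (Nat.succ_le_succ (Fin.le_def.mp (hyK.trans hz))).trans (lt_colBound hjz)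
    · apply lt_colBound
      rw [code_mul_swap h.succ h.ascent,
        Equiv.swap_apply_of_ne_of_ne (fun e => hyK (by rw [e]; exact hlt.le)) (fun e => hyK e.le)]
      omega

/-- The row that gains a box in `w s_K` may be given the flag `K + 1`: the positions with code
`code w K'` from `K'` on are contiguous, so the corner of its block does not force a larger one. -/
theorem isRowBound (h : IsTopAscent w K K') (hw : IsVexillary w) :
    IsRowBound w (Function.update (lastBound w) (colHeight w (code w K')) (K + 2)) := by
  set m := code w K' with hm
  have hsc := h.succ
  -- the row of the new box can only be a row of length `m`
  have hrow : ∀ j, colHeight w m < colHeight w j → colHeight w (j + 1) ≤ colHeight w m →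
      j + 1 = m := by
    intro j h1 h2
    have hjm : j < m := by
      by_contra hlt
      have := colHeight_anti w (not_lt.mp hlt)
      omega
    by_contra hne
    have := colHeight_lt_of_code_eq (show j + 1 < m by omega) hm.symm
    omega
  have hle : ∀ d j, j + 1 = m → colHeight w m + d + 1 = colHeight w j →
      colBound w j ≤ K + 2 + d := by
    intro d j hj hd
    have hcard := colHeight_eq_add w j
    rw [hj] at hcard
    refine colBound_le fun x hx => ?_
    rcases Nat.lt_or_ge m (code w x) with h1 | h1
    · have := Fin.lt_def.mp (h.lt_of_code_gt h1)
      omega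
    · have hxm : code w x = m := by omega
      rcases lt_or_ge x K' with h2 | h2
      · have := Fin.lt_def.mp h2
        omega
      · have hsub : Finset.Icc K' x ⊆ ({y : Fin n | code w y = m} : Finset (Fin n)) := by
          intro y hy
          rw [Finset.mem_Icc] at hy
          simp only [Finset.mem_filter, Finset.mem_univ, true_and]
          exact h.code_eq_of_le hw hxm hy.1 hy.2
        have h3 := Finset.card_le_card hsub
        rw [Fin.card_Icc] at h3
        omega
  constructor
  · intro i j h1 h2
    by_cases hi : i = colHeight w m
    · have hj := hrow j (by omega) (by omega)
      subst hi
      rw [Function.update_self]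
      have := lt_colBound (w := w) (j := j) (x := K') (by omega)
      omega
    · rw [Function.update_of_ne hi, lastBound_eq (by omega) h2]
  · intro i d j h1 h2
    by_cases hi : i = colHeight w m
    · subst hi
      rw [Function.update_self]
      exact hle d j (hrow j (by omega) (by omega)) h1
    · rw [Function.update_of_ne hi, lastBound_eq (by omega) h2]
      omega

/-- With the flag of the row that gains a box lowered to `K`, the row bounds for `w` become row
bounds for `w s_K`. -/
theorem isRowBound_swap (h : IsTopAscent w K K') (hw : IsVexillary w) :
    IsRowBound (w * Equiv.swap K K')
      (Function.update (lastBound w) (colHeight w (code w K')) (K + 1)) := by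
  set m := code w K' with hm
  have hH : ∀ j, colHeight (w * Equiv.swap K K') j = colHeight w j + if j = m then 1 else 0 :=
    h.colHeight_swap
  have hne : ∀ i j, j ≠ m → i < colHeight (w * Equiv.swap K K') j →
      colHeight (w * Equiv.swap K K') (j + 1) ≤ i →
      Function.update (lastBound w) (colHeight w m) (K + 1) i
        = colBound (w * Equiv.swap K K') j := by
    intro i j hj h1 h2
    rw [hH, if_neg hj] at h1
    rw [hH] at h2
    have h3 : i ≠ colHeight w m := by
      rcases Nat.lt_or_gt_of_ne hj with hlt | hgt
      · rcases Nat.lt_or_ge (j + 1) m with h4 | h4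
        · have := colHeight_lt_of_code_eq h4 hm.symm
          omega
        · rw [if_pos (by omega), show j + 1 = m by omega] at h2
          omega
      · have := colHeight_anti w hgt.le
        omega
    rw [Function.update_of_ne h3, lastBound_eq (by omega) (by omega)]
    rcases Nat.lt_or_gt_of_ne hj with hlt | hgt
    · have hex : ∃ x, x ≠ K' ∧ code w x = j + 1 := by
        rcases Nat.lt_or_ge (j + 1) m with h4 | h4
        · obtain ⟨x, hx⟩ := exists_code_eq (w := w) (j := j) (by omega)
          exact ⟨x, fun e => by rw [e] at hx; omega, hx⟩
        · have h5 : j + 1 = m := by omega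
          have hcard := colHeight_eq_add w j
          rw [if_pos h5] at h2
          obtain ⟨x, hx, hx'⟩ := Finset.exists_mem_ne (s := {x : Fin n | code w x = j + 1})
            (by omega) K'
          exact ⟨x, hx', by simpa using hx⟩
      obtain ⟨x, hx, hxj⟩ := hex
      exact (h.colBound_swap_of_lt hw hlt hx hxj).symm
    · exact (h.colBound_swap_of_gt hgt).symm
  constructor
  · intro i j h1 h2
    by_cases hj : j = m
    · rw [hH, if_pos hj] at h1
      rw [hj] at h1 ⊢
      have hi : i = colHeight w m := by omega
      rw [hi, Function.update_self, h.colBound_swap_self]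
    · exact (hne i j hj (by omega) h2).le
  · intro i d j h1 h2
    by_cases hj : j = m
    · subst hj
      rw [h.colBound_swap_self]
      rw [hH, if_pos rfl] at h1
      rw [hH, if_neg (by omega)] at h2
      by_cases hd : d = 0
      · have hi : i = colHeight w m := by omega
        rw [hi, Function.update_self]
        omega
      · rw [Function.update_of_ne (by omega), lastBound_eq (j := m) (by omega) (by omega)]
        obtain ⟨x, hx⟩ := exists_code_eq (w := w) (j := m) (by omega)
        have h3 := h.succ_eq_of_code_eq hw hx
        have h4 := lt_colBound (w := w) (j := m) (x := x) (by omega)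
        omega
    · rw [hne i j hj (by omega) h2]
      omega

theorem dividedDiff_tabSum_swap (h : IsTopAscent w K K') :
    dividedDiff K (tabSum (codeShape (w * Equiv.swap K K')).cells
        (Function.update (lastBound w) (colHeight w (code w K')) (K + 1)))
      = tabSum (codeShape w).cells
        (Function.update (lastBound w) (colHeight w (code w K')) (K + 2)) := by
  set m := code w K' with hm
  have hup : ∀ s, s < colHeight w m → lastBound w s ≤ K := by
    intro s hs
    refine colBound_le fun x hx => ?_
    have h1 := (YoungDiagram.mem_iff_lt_rowLen (μ := codeShape w)).mp (mem_codeShape.mpr hs)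
    have := Fin.lt_def.mp (h.lt_of_code_gt (x := x) (by omega))
    omega
  have hdown : ∀ s, colHeight w m < s → (s, 0) ∈ (codeShape (w * Equiv.swap K K')).cells →
      K + 2 ≤ lastBound w s := by
    intro s hs hsS
    have h0 : (s, 0) ∈ (codeShape w).cells := by
      rw [← h.erase_codeShape_swap, Finset.mem_erase]
      exact ⟨fun e => hs.ne' (Prod.mk.inj e).1, hsS⟩
    have h1 := (YoungDiagram.mem_iff_lt_rowLen (μ := codeShape w)).mp h0
    have h2 : ¬ m < (codeShape w).rowLen s := fun hlt => by
      have := mem_codeShape.mp ((YoungDiagram.mem_iff_lt_rowLen (μ := codeShape w)).mpr hlt)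
      omega
    have h3 := lt_colBound (w := w) (j := (codeShape w).rowLen s - 1) (x := K') (by omega)
    have := h.succ
    rw [lastBound]
    omega
  have key := dividedDiff_tabSum (codeShape (w * Equiv.swap K K')).isLowerSet
    (b := Function.update (lastBound w) (colHeight w m) (K + 1)) (k := K) h.mem_swap
    (by
      rw [mem_codeShape, h.colHeight_swap, if_neg (by omega)]
      have := colHeight_anti w (Nat.le_add_right (code w K') 1)
      omega)
    (by
      rw [mem_codeShape, h.colHeight_swap, if_pos rfl]
      omega)
    (by
      intro s s' hss hs'
      by_cases e : s = colHeight w m <;> by_cases e' : s' = colHeight w m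
      · rw [e, e']
      · rw [e, Function.update_self, Function.update_of_ne e']
        have := hdown s' (by omega) hs'
        omega
      · rw [e', Function.update_self, Function.update_of_ne e]
        have := hup s (by omega)
        omega
      · rw [Function.update_of_ne e, Function.update_of_ne e']
        exact lastBound_mono w hss)
    (by rw [Function.update_self])
    (fun s hs => by rw [Function.update_of_ne hs.ne]; exact hup s hs)
    (fun s hs hsS => by rw [Function.update_of_ne hs.ne']; exact hdown s hs hsS)
  rw [key, h.erase_codeShape_swap, Function.update_idem]

end IsTopAscent

/-- The Grothendieck polynomial of a vexillary permutation is the tableau sum given by its code. -/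
theorem grothendieck_eq_tabSum {w : Equiv.Perm (Fin n)} (hw : IsVexillary w) {b : ℕ → ℕ}
    (hb : IsRowBound w b) : grothendieck w = tabSum (codeShape w).cells b := by
  induction hN : n * n - length w using Nat.strong_induction_on generalizing w b with
  | _ N ih =>
  by_cases hrev : w = Fin.revPerm
  · subst hrev
    exact grothendieck_revPerm_eq hb
  · obtain ⟨K, K', h⟩ := exists_isTopAscent hrev
    have hsc := h.succ
    have hs : simple n K = Equiv.swap K K' := by
      have h1 : (K : ℕ) + 1 < n := by omega
      rw [simple, dif_pos h1]
      congr 1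
      exact Fin.ext hsc.symm
    have hlen : length (w * simple n K) = length w + 1 := by
      refine length_mul_simple_of_lt w (by omega) ?_
      convert h.ascent using 2
      exact Fin.ext hsc.symm
    have hle := length_le (w * simple n K)
    rw [grothendieck_eq w K hlen, hb.tabSum_eq (h.isRowBound hw), ← h.dividedDiff_tabSum_swap,
      ih _ (by omega) (hs ▸ h.swap_vexillary hw) (hs ▸ h.isRowBound_swap hw) rfl, hs]

/-! ### Flagged Grothendieck polynomials as tableau sums -/

theorem flaggedGrothendieck_eq_tabSum (μ : YoungDiagram) (f : ℕ → ℕ) :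
    flaggedGrothendieck μ f = tabSum μ.cells fun i => f i + 1 := by
  rw [flaggedGrothendieck, tabSum]
  refine Finset.sum_bij' (fun T _ c => if h : c ∈ μ.cells then T ⟨c, h⟩ else ∅)
    (fun T _ c => T c.1) ?_ ?_ ?_ ?_ ?_
  · intro T hT
    simp only [FSVT, Finset.mem_filter, Fintype.mem_piFinset, Finset.mem_powerset] at hT
    obtain ⟨hb, hne, hrow, hcol⟩ := hT
    rw [mem_tableaux]
    have hmem : ∀ {c a}, a ∈ (if h : c ∈ μ.cells then T ⟨c, h⟩ else ∅) →
        ∃ h : c ∈ μ.cells, a ∈ T ⟨c, h⟩ := by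
      intro c a ha
      split_ifs at ha with h
      · exact ⟨h, ha⟩
      · simp at ha
    refine ⟨fun c hc => dif_neg hc, ?_, ?_, ?_, ?_⟩
    · intro i j a ha
      obtain ⟨h, ha⟩ := hmem ha
      exact Nat.lt_succ_of_le (Finset.mem_Iic.mp (hb _ ha))
    · intro c hc
      rw [dif_pos hc]
      exact hne _
    · intro i j a ha e he
      obtain ⟨h, ha⟩ := hmem ha
      obtain ⟨h', he⟩ := hmem he
      exact hrow ⟨_, h⟩ ⟨_, h'⟩ rfl _ ha _ he
    · intro i j a ha e he
      obtain ⟨h, ha⟩ := hmem ha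
      obtain ⟨h', he⟩ := hmem he
      exact hcol ⟨_, h⟩ ⟨_, h'⟩ rfl _ ha _ he
  · intro T hT
    rw [mem_tableaux] at hT
    simp only [FSVT, Finset.mem_filter, Fintype.mem_piFinset, Finset.mem_powerset]
    refine ⟨fun c a ha => ?_, fun c => hT.nonempty _ c.2, ?_, ?_⟩
    · exact Finset.mem_Iic.mpr (Nat.le_of_lt_succ (hT.lt_bound _ _ _ ha))
    · rintro ⟨⟨i, j⟩, hc⟩ ⟨d, hd⟩ hcd a ha e he
      subst hcd
      exact hT.row_le _ _ _ ha _ he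
    · rintro ⟨⟨i, j⟩, hc⟩ ⟨d, hd⟩ hcd a ha e he
      subst hcd
      exact hT.col_lt _ _ _ ha _ he
  · intro T _
    funext c
    exact dif_pos c.2
  · intro T hT
    rw [mem_tableaux] at hT
    funext c
    by_cases hc : c ∈ μ.cells
    · simp only [hc, dif_pos]
    · simp only [hc, dif_neg, not_false_eq_true, hT.eq_empty c hc]
  · intro T hT
    simp only [FSVT, Finset.mem_filter] at hT
    have hcard : (∑ c, (T c).card) - μ.card = ∑ c, ((T c).card - 1) := by
      rw [Finset.sum_tsub_distrib _ fun c _ => (hT.2.1 c).card_pos]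
      simp [YoungDiagram.card]
    rw [hcard, ← Finset.prod_pow_eq_pow_sum, ← Finset.prod_mul_distrib,
      ← Finset.prod_coe_sort μ.cells]
    refine Finset.prod_congr rfl fun c _ => ?_
    simp only [c.2, dif_pos]
    rfl

/-! ### The shape -/

/-- A partition is determined by the numbers of boxes on its diagonals. -/
theorem le_of_diagonals {μ ν : YoungDiagram}
    (h : ∀ k : ℤ, Finset.card {c ∈ μ.cells | (c.2 : ℤ) - (c.1 : ℤ) = k}
      = Finset.card {c ∈ ν.cells | (c.2 : ℤ) - (c.1 : ℤ) = k}) : μ ≤ ν := by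
  rw [← YoungDiagram.cells_subset_iff]
  rintro ⟨i, j⟩ hμ
  by_contra hν
  refine absurd (h ((j : ℤ) - i)) (ne_of_gt (Finset.card_lt_card
    (Finset.ssubset_iff_of_subset ?_ |>.mpr ⟨(i, j), by simpa using hμ, by simpa using hν⟩)))
  rintro ⟨i', j'⟩ hc
  rw [Finset.mem_filter] at hc ⊢
  refine ⟨?_, hc.2⟩
  have h2 := hc.2
  simp only at h2
  rcases Nat.lt_or_ge i' i with hi | hi
  · exact μ.isLowerSet (Prod.mk_le_mk.mpr ⟨by omega, by omega⟩) hμ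
  · exact absurd (ν.isLowerSet (Prod.mk_le_mk.mpr ⟨hi, by omega⟩) hc.1) hν

theorem IsShape.unique {w : Equiv.Perm (Fin n)} {μ ν : YoungDiagram} (hμ : IsShape w μ)
    (hν : IsShape w ν) : μ = ν :=
  le_antisymm (le_of_diagonals fun k => (hμ k).trans (hν k).symm)
    (le_of_diagonals fun k => (hν k).trans (hμ k).symm)

/-- The boxes of the diagram are the pairs `(p, w y)` for the inversions `p < y`. -/
theorem mem_diagram {w : Equiv.Perm (Fin n)} {a b : ℕ} :
    (a, b) ∈ diagram w ↔ ∃ p y : Fin n, p < y ∧ w y < w p ∧ (p : ℕ) = a ∧ (w y : ℕ) = b := by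
  simp only [diagram, Finset.mem_image, Finset.mem_filter, Finset.mem_univ, true_and, Prod.exists,
    Prod.mk.injEq]
  constructor
  · rintro ⟨p, q, ⟨h1, h2⟩, h3, h4⟩
    exact ⟨p, w.symm q, h2, by simpa using h1, h3, by simpa using h4⟩
  · rintro ⟨p, y, h1, h2, h3, h4⟩
    exact ⟨p, w y, ⟨h2, by simpa using h1⟩, h3, h4⟩

theorem mem_diagram_coe {w : Equiv.Perm (Fin n)} {p y : Fin n} :
    ((p : ℕ), (w y : ℕ)) ∈ diagram w ↔ p < y ∧ w y < w p := by
  rw [mem_diagram]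
  constructor
  · rintro ⟨p', y', h1, h2, h3, h4⟩
    obtain rfl := Fin.ext h3
    obtain rfl := w.injective (Fin.ext h4)
    exact ⟨h1, h2⟩
  · rintro ⟨h1, h2⟩
    exact ⟨p, y, h1, h2, rfl, rfl⟩

/-- For an inversion `p < y`, the number of boxes of the diagram to the left of the box
`(p, w y)`. -/
def boxIndex (w : Equiv.Perm (Fin n)) (p y : Fin n) : ℕ :=
  Finset.card {z : Fin n | p < z ∧ w z < w y}

theorem card_le_eq_boxIndex {w : Equiv.Perm (Fin n)} {p y : Fin n} (h : p < y) :
    Finset.card {z : Fin n | p < z ∧ w z ≤ w y} = boxIndex w p y + 1 := by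
  rw [boxIndex, ← Finset.card_insert_of_notMem (a := y) (by simp)]
  congr 1
  ext z
  simp only [Finset.mem_filter, Finset.mem_univ, true_and, Finset.mem_insert]
  constructor
  · rintro ⟨h1, h2⟩
    rcases h2.lt_or_eq with h3 | h3
    · exact Or.inr ⟨h1, h3⟩
    · exact Or.inl (w.injective h3)
  · rintro (rfl | ⟨h1, h2⟩)
    · exact ⟨h, le_rfl⟩
    · exact ⟨h1, h2.le⟩

theorem boxIndex_lt {w : Equiv.Perm (Fin n)} {p y y' : Fin n} (h : p < y) (hy : w y < w y') :
    boxIndex w p y < boxIndex w p y' := by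
  refine Finset.card_lt_card
    (Finset.ssubset_iff_of_subset ?_ |>.mpr ⟨y, by simp [h, hy], by simp⟩)
  exact Finset.monotone_filter_right _ fun z _ hz => ⟨hz.1, hz.2.trans hy⟩

theorem boxIndex_lt_code {w : Equiv.Perm (Fin n)} {p y x : Fin n} (h : p < y) (hx : x ≤ p)
    (hy : w y < w x) : boxIndex w p y < code w x := by
  rw [← Nat.succ_le_iff, ← Nat.add_one, ← card_le_eq_boxIndex h]
  exact Finset.card_le_card
    (Finset.monotone_filter_right _ fun z _ hz => ⟨hx.trans_lt hz.1, hz.2.trans_lt hy⟩)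

/-- In a vexillary permutation, the positions up to `p` with values above those of a box in row `p`
are recognized by their codes. -/
theorem IsVexillary.lt_iff_boxIndex_lt {w : Equiv.Perm (Fin n)} (hw : IsVexillary w)
    {p y x : Fin n} (h : p < y) (hyp : w y < w p) (hx : x ≤ p) :
    w y < w x ↔ boxIndex w p y < code w x := by
  refine ⟨boxIndex_lt_code h hx, fun hlt => ?_⟩
  by_contra hcon
  have hxy : w x < w y :=
    lt_of_le_of_ne (not_lt.mp hcon) (by simp [(hx.trans_lt h).ne])
  have hxp : x < p := lt_of_le_of_ne hx fun e => by
    rw [e] at hxy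
    exact lt_asymm hxy hyp
  have hno : ∀ l, x < l → l < p → w x < w l := by
    intro l h1 h2
    by_contra h3
    exact lt_asymm hxy (hw.lt_of_lt h1 h2
      (lt_of_le_of_ne (not_lt.mp h3) (by simp [h1.ne'])) h hyp)
  rw [code_eq_card_of_forall hxp (hxy.trans hyp) hno] at hlt
  exact absurd hlt (not_lt.mpr (Finset.card_le_card
    (Finset.monotone_filter_right _ fun z _ hz => ⟨hz.1, hz.2.trans hxy⟩)))

/-- An element of given rank with respect to an injective function. -/
theorem exists_card_filter_lt_eq {α : Type*} [DecidableEq α] {s : Finset α} {f : α → ℕ}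
    (hf : Set.InjOn f s) {i : ℕ} (hi : i < s.card) :
    ∃ p ∈ s, (s.filter fun x => f x < f p).card = i := by
  induction hN : s.card generalizing s with
  | zero => omega
  | succ N ih =>
    obtain ⟨q, hq, hmax⟩ := s.exists_max_image f (Finset.card_pos.mp (by omega))
    have herase : s.filter (fun x => f x < f q) = s.erase q := by
      ext x
      rw [Finset.mem_filter, Finset.mem_erase]
      constructor
      · rintro ⟨h1, h2⟩
        exact ⟨fun e => by rw [e] at h2; omega, h1⟩
      · rintro ⟨h1, h2⟩
        exact ⟨h2, lt_of_le_of_ne (hmax x h2) fun e => h1 (hf h2 hq e)⟩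
    have hcard := Finset.card_erase_of_mem hq
    by_cases hiN : i = N
    · exact ⟨q, hq, by rw [herase]; omega⟩
    · obtain ⟨p, hp, hp'⟩ := ih (s := s.erase q)
        (hf.mono (by exact_mod_cast Finset.erase_subset q s)) (by omega) (by omega)
      refine ⟨p, Finset.mem_of_mem_erase hp, ?_⟩
      rw [← hp']
      congr 1
      ext x
      rw [Finset.mem_filter, Finset.mem_filter, Finset.mem_erase]
      refine ⟨fun ⟨h1, h2⟩ => ⟨⟨fun e => ?_, h1⟩, h2⟩, fun ⟨h1, h2⟩ => ⟨h1.2, h2⟩⟩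
      have := hmax p (Finset.mem_of_mem_erase hp)
      rw [e] at h2
      omega

theorem exists_boxIndex_eq {w : Equiv.Perm (Fin n)} {p : Fin n} {j : ℕ} (hj : j < code w p) :
    ∃ y, p < y ∧ w y < w p ∧ boxIndex w p y = j := by
  obtain ⟨y, hy, hy'⟩ := exists_card_filter_lt_eq
    (s := ({y : Fin n | p < y ∧ w y < w p} : Finset (Fin n))) (f := fun y => (w y : ℕ))
    (fun a _ b _ h => w.injective (Fin.ext h)) hj
  simp only [Finset.mem_filter, Finset.mem_univ, true_and] at hy
  refine ⟨y, hy.1, hy.2, ?_⟩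
  rw [← hy', boxIndex, Finset.filter_filter]
  refine congrArg Finset.card (Finset.filter_congr fun z _ => ?_)
  exact ⟨fun h => ⟨⟨h.1, h.2.trans hy.2⟩, h.2⟩, fun h => ⟨h.1.1, h.2⟩⟩

/-- The box `(p, w y)` of the diagram lies on the same diagonal as the box obtained by moving it
northwest by as many steps as there are dots northwest of it. -/
theorem boxIndex_sub {w : Equiv.Perm (Fin n)} {p y : Fin n} (h : p < y) (hyp : w y < w p) :
    (boxIndex w p y : ℤ) - Finset.card {x : Fin n | x < p ∧ w y < w x}
      = (w y : ℤ) - (p : ℤ) := by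
  have h1 : Finset.card {z : Fin n | w z < w y} = (w y : ℕ) := by
    rw [← Fin.card_Iio]
    refine Finset.card_bij (fun z _ => w z) (by simp) (by simp) fun b hb => ?_
    exact ⟨w.symm b, by simpa using hb, by simp⟩
  have h2 : Finset.card {z : Fin n | w z < w y}
      = boxIndex w p y + Finset.card {x : Fin n | x < p ∧ w x < w y} := by
    rw [boxIndex, ← Finset.card_union_of_disjoint]
    · congr 1
      ext z
      simp only [Finset.mem_filter, Finset.mem_univ, true_and, Finset.mem_union]
      constructor
      · intro hz
        rcases lt_trichotomy z p with h3 | h3 | h3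
        · exact Or.inr ⟨h3, hz⟩
        · rw [h3] at hz
          exact absurd hz (lt_asymm hyp)
        · exact Or.inl ⟨h3, hz⟩
      · rintro (h3 | h3)
        · exact h3.2
        · exact h3.2
    · rw [Finset.disjoint_filter]
      rintro z - ⟨h3, -⟩ ⟨h4, -⟩
      exact lt_asymm h3 h4
  have h3 : (p : ℕ) = Finset.card {x : Fin n | x < p ∧ w y < w x}
      + Finset.card {x : Fin n | x < p ∧ w x < w y} := by
    rw [← Finset.card_union_of_disjoint]
    · conv_lhs => rw [← Fin.card_Iio p]
      congr 1
      ext z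
      simp only [Finset.mem_filter, Finset.mem_univ, true_and, Finset.mem_union, Finset.mem_Iio]
      constructor
      · intro hz
        have hne : w z ≠ w y := by simp [(hz.trans h).ne]
        rcases lt_or_gt_of_ne hne with h4 | h4
        · exact Or.inr ⟨hz, h4⟩
        · exact Or.inl ⟨hz, h4⟩
      · rintro (h4 | h4)
        · exact h4.1
        · exact h4.1
    · rw [Finset.disjoint_filter]
      rintro z - ⟨-, h4⟩ ⟨-, h5⟩
      exact lt_asymm h4 h5
  omega

/-- Sorting the rows of the diagram of a vexillary permutation and pushing them to the left moves
every box along its diagonal. -/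
theorem IsVexillary.isShape_codeShape {w : Equiv.Perm (Fin n)} (hw : IsVexillary w) :
    IsShape w (codeShape w) := by
  intro k
  have hrow : ∀ p y : Fin n, p < y → w y < w p →
      Finset.card {x : Fin n | x < p ∧ boxIndex w p y < code w x}
        = Finset.card {x : Fin n | x < p ∧ w y < w x} := fun p y h1 h2 =>
    congrArg Finset.card (Finset.filter_congr fun x _ =>
      and_congr_right fun h3 => (hw.lt_iff_boxIndex_lt h1 h2 h3.le).symm)
  have hinj : ∀ (j : ℕ) (p p' : Fin n), j < code w p → p < p' →
      Finset.card {x : Fin n | x < p ∧ j < code w x}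
        < Finset.card {x : Fin n | x < p' ∧ j < code w x} := by
    intro j p p' h1 h2
    refine Finset.card_lt_card
      (Finset.ssubset_iff_of_subset ?_ |>.mpr ⟨p, by simp [h1, h2], by simp⟩)
    exact Finset.monotone_filter_right _ fun z _ hz => ⟨hz.1.trans h2, hz.2⟩
  trans Finset.card {c : Fin n × Fin n | c.1 < c.2 ∧ w c.2 < w c.1 ∧ (w c.2 : ℤ) - (c.1 : ℤ) = k}
  · symm
    refine Finset.card_bij (fun c _ =>
      (Finset.card {x : Fin n | x < c.1 ∧ boxIndex w c.1 c.2 < code w x}, boxIndex w c.1 c.2))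
      ?_ ?_ ?_
    · rintro ⟨p, y⟩ hc
      simp only [Finset.mem_filter, Finset.mem_univ, true_and] at hc ⊢
      obtain ⟨h1, h2, h3⟩ := hc
      refine ⟨mem_codeShape.mpr (Finset.card_lt_card
        (Finset.ssubset_iff_of_subset ?_ |>.mpr ⟨p, ?_, by simp⟩)), ?_⟩
      · exact Finset.monotone_filter_right _ fun z _ hz => hz.2
      · simpa using boxIndex_lt_code h1 le_rfl h2
      · rw [hrow p y h1 h2, boxIndex_sub h1 h2, h3]
    · rintro ⟨p, y⟩ hc ⟨p', y'⟩ hc' heq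
      simp only [Finset.mem_filter, Finset.mem_univ, true_and, Prod.mk.injEq] at hc hc' heq ⊢
      obtain ⟨h1, h2, -⟩ := hc
      obtain ⟨h1', h2', -⟩ := hc'
      obtain ⟨h3, h4⟩ := heq
      have h5 := boxIndex_lt_code h1 le_rfl h2
      have h5' := boxIndex_lt_code h1' le_rfl h2'
      rw [← h4] at h3 h5'
      have hp : p = p' := by
        rcases lt_trichotomy p p' with h6 | h6 | h6
        · exact absurd h3 (hinj _ _ _ h5 h6).ne
        · exact h6
        · exact absurd h3 (hinj _ _ _ h5' h6).ne'
      subst hp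
      refine ⟨rfl, ?_⟩
      rcases lt_trichotomy (w y) (w y') with h6 | h6 | h6
      · exact absurd h4 (boxIndex_lt h1 h6).ne
      · exact w.injective h6
      · exact absurd h4 (boxIndex_lt h1' h6).ne'
    · rintro ⟨i, j⟩ hc
      rw [Finset.mem_filter, mem_codeShape] at hc
      obtain ⟨p, hp, hpi⟩ := exists_card_filter_lt_eq
        (s := ({x : Fin n | j < code w x} : Finset (Fin n))) (f := fun x => (x : ℕ))
        (fun a _ b _ h => Fin.ext h) hc.1
      simp only [Finset.mem_filter, Finset.mem_univ, true_and] at hp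
      obtain ⟨y, h1, h2, h3⟩ := exists_boxIndex_eq hp
      have hi : Finset.card {x : Fin n | x < p ∧ boxIndex w p y < code w x} = i := by
        rw [← hpi, Finset.filter_filter, h3]
        exact congrArg Finset.card (Finset.filter_congr fun z _ => and_comm)
      refine ⟨(p, y), ?_, Prod.ext hi h3⟩
      simp only [Finset.mem_filter, Finset.mem_univ, true_and]
      refine ⟨h1, h2, ?_⟩
      rw [← boxIndex_sub h1 h2, ← hrow p y h1 h2, hi, h3]
      exact hc.2
  · refine Finset.card_bij (fun c _ => ((c.1 : ℕ), (w c.2 : ℕ))) ?_ ?_ ?_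
    · rintro ⟨p, y⟩ hc
      simp only [Finset.mem_filter, Finset.mem_univ, true_and] at hc ⊢
      exact ⟨mem_diagram_coe.mpr ⟨hc.1, hc.2.1⟩, hc.2.2⟩
    · rintro ⟨p, y⟩ - ⟨p', y'⟩ - heq
      simp only [Prod.mk.injEq] at heq ⊢
      exact ⟨Fin.ext heq.1, w.injective (Fin.ext heq.2)⟩
    · rintro ⟨a, b⟩ hc
      rw [Finset.mem_filter, mem_diagram] at hc
      obtain ⟨⟨p, y, h1, h2, rfl, rfl⟩, hk⟩ := hc
      exact ⟨(p, y), by simp [h1, h2]; exact hk, rfl⟩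

/-! ### Essential boxes and flagging sets -/

/-- The number of dots weakly above row `p` and strictly to the right of column `q`. A flagging set
selects boxes with prescribed values of this function. -/
def dotsAbove (w : Equiv.Perm (Fin n)) (p q : ℕ) : ℕ :=
  Finset.card {x : Fin n | (x : ℕ) ≤ p ∧ q < (w x : ℕ)}

theorem rank_add_dotsAbove (w : Equiv.Perm (Fin n)) {p : ℕ} (q : ℕ) (hp : p < n) :
    rank w p q + dotsAbove w p q = p + 1 := by
  rw [rank, dotsAbove, ← Finset.card_union_of_disjoint]
  · have : p + 1 = (Finset.Iic (⟨p, hp⟩ : Fin n)).card := by simp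
    rw [this]
    congr 1
    ext x
    simp only [Finset.mem_union, Finset.mem_filter, Finset.mem_univ, true_and, Finset.mem_Iic,
      Fin.le_def]
    omega
  · rw [Finset.disjoint_filter]
    intro x _ h
    omega

theorem dotsAbove_mono (w : Equiv.Perm (Fin n)) {p p' q q' : ℕ} (hp : p ≤ p') (hq : q' ≤ q) :
    dotsAbove w p q ≤ dotsAbove w p' q' :=
  Finset.card_le_card
    (Finset.monotone_filter_right _ fun _ _ hx => ⟨hx.1.trans hp, hq.trans_lt hx.2⟩)

theorem dotsAbove_succ_left_le (w : Equiv.Perm (Fin n)) (p q : ℕ) :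
    dotsAbove w (p + 1) q ≤ dotsAbove w p q + 1 := by
  have hone : Finset.card {x : Fin n | (x : ℕ) = p + 1} ≤ 1 :=
    Finset.card_le_one.mpr fun a ha b hb => by
      simp only [Finset.mem_filter, Finset.mem_univ, true_and] at ha hb
      exact Fin.ext (ha.trans hb.symm)
  refine le_trans (Finset.card_le_card ?_) ((Finset.card_union_le _ _).trans
    (Nat.add_le_add_left hone _))
  intro x hx
  simp only [Finset.mem_union, Finset.mem_filter, Finset.mem_univ, true_and] at hx ⊢
  omega

theorem dotsAbove_le_succ_right (w : Equiv.Perm (Fin n)) (p q : ℕ) :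
    dotsAbove w p q ≤ dotsAbove w p (q + 1) + 1 := by
  have hone : Finset.card {x : Fin n | (w x : ℕ) = q + 1} ≤ 1 :=
    Finset.card_le_one.mpr fun a ha b hb => by
      simp only [Finset.mem_filter, Finset.mem_univ, true_and] at ha hb
      exact w.injective (Fin.ext (ha.trans hb.symm))
  refine le_trans (Finset.card_le_card ?_) ((Finset.card_union_le _ _).trans
    (Nat.add_le_add_left hone _))
  intro x hx
  simp only [Finset.mem_union, Finset.mem_filter, Finset.mem_univ, true_and] at hx ⊢
  omega

/-- The box `(P, w Y)` of the diagram lies in the last row with more than `j` boxes, and has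
exactly `j` boxes to its left. If `j + 1` occurs in the code, these are the essential boxes. -/
structure IsCornerBox (w : Equiv.Perm (Fin n)) (j : ℕ) (P Y : Fin n) : Prop where
  lt : P < Y
  apply_lt : w Y < w P
  index : boxIndex w P Y = j
  last : ∀ x, j < code w x → x ≤ P

theorem exists_isCornerBox {w : Equiv.Perm (Fin n)} {j : ℕ} (h : 0 < colHeight w j) :
    ∃ P Y, IsCornerBox w j P Y := by
  obtain ⟨P, hP, hmax⟩ := ({x : Fin n | j < code w x} : Finset (Fin n)).exists_max_image id
    (Finset.card_pos.mp h)
  simp only [Finset.mem_filter, Finset.mem_univ, true_and, id] at hP hmax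
  obtain ⟨Y, h1, h2, h3⟩ := exists_boxIndex_eq hP
  exact ⟨P, Y, h1, h2, h3, hmax⟩

namespace IsCornerBox

variable {w : Equiv.Perm (Fin n)} {j j' : ℕ} {P Y P' Y' : Fin n}

theorem lt_code (h : IsCornerBox w j P Y) : j < code w P := by
  have := boxIndex_lt_code h.lt le_rfl h.apply_lt
  rwa [h.index] at this

theorem lt_iff (h : IsCornerBox w j P Y) (hw : IsVexillary w) {x : Fin n} (hx : x ≤ P) :
    w Y < w x ↔ j < code w x := by
  rw [hw.lt_iff_boxIndex_lt h.lt h.apply_lt hx, h.index]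

theorem le_of_le (h : IsCornerBox w j P Y) (h' : IsCornerBox w j' P' Y') (hj : j' ≤ j) :
    P ≤ P' :=
  h'.last _ (hj.trans_lt h.lt_code)

theorem apply_le_of_eq (h : IsCornerBox w j P Y) (h' : IsCornerBox w j' P Y') (hj : j' ≤ j) :
    w Y' ≤ w Y := by
  by_contra hlt
  have := boxIndex_lt h.lt (not_le.mp hlt)
  rw [h.index, h'.index] at this
  omega

theorem unique (h : IsCornerBox w j P Y) (h' : IsCornerBox w j P' Y') : P = P' ∧ Y = Y' := by
  have hP := le_antisymm (h.le_of_le h' le_rfl) (h'.le_of_le h le_rfl)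
  subst hP
  exact ⟨rfl, w.injective (le_antisymm (h'.apply_le_of_eq h le_rfl) (h.apply_le_of_eq h' le_rfl))⟩

theorem dotsAbove_eq (h : IsCornerBox w j P Y) (hw : IsVexillary w) :
    dotsAbove w P (w Y) = colHeight w j := by
  refine congrArg Finset.card (Finset.filter_congr fun x _ => ?_)
  rw [← Fin.le_def, ← Fin.lt_def]
  exact ⟨fun hx => (h.lt_iff hw hx.1).mp hx.2, fun hx =>
    ⟨h.last x hx, (h.lt_iff hw (h.last x hx)).mpr hx⟩⟩

theorem colBound_eq (h : IsCornerBox w j P Y) : colBound w j = P + 1 :=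
  le_antisymm (colBound_le fun x hx => Nat.succ_le_succ (Fin.le_def.mp (h.last x hx)))
    (lt_colBound h.lt_code)

theorem mem_essentialSet (h : IsCornerBox w j P Y) (hw : IsVexillary w)
    (hj : colHeight w (j + 1) < colHeight w j) : ((P : ℕ), (w Y : ℕ)) ∈ essentialSet w := by
  rw [essentialSet, Finset.mem_filter]
  refine ⟨mem_diagram_coe.mpr ⟨h.lt, h.apply_lt⟩, fun hd => ?_, fun hd => ?_⟩
  · obtain ⟨p, y, h1, h2, h3, h4⟩ := mem_diagram.mp hd
    obtain rfl := w.injective (Fin.ext h4)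
    have hPp : P < p := Fin.lt_def.mpr (by simp only at h3; omega)
    have hcode : j < code w p := by
      rw [← h.index, ← Nat.succ_le_iff, ← Nat.add_one, ← card_le_eq_boxIndex h.lt]
      refine Finset.card_le_card (Finset.monotone_filter_right _ fun z _ hz => ?_)
      refine ⟨lt_of_le_of_ne (Fin.le_def.mpr ?_) fun e => ?_, hz.2.trans_lt h2⟩
      · have := Fin.lt_def.mp hz.1
        simp only at h3
        omega
      · rw [← e] at hz
        exact absurd h2 (not_lt.mpr hz.2)
    exact absurd (h.last p hcode) (not_le.mpr hPp)
  · obtain ⟨p, y, h1, h2, h3, h4⟩ := mem_diagram.mp hd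
    obtain rfl := Fin.ext h3
    simp only at h4
    obtain ⟨x, hx⟩ := exists_code_eq hj
    have hindex : boxIndex w p y = j + 1 := by
      rw [← h.index, ← card_le_eq_boxIndex h.lt, boxIndex]
      refine congrArg Finset.card (Finset.filter_congr fun z _ => ?_)
      rw [Fin.lt_def (a := w z), Fin.le_def, h4, Nat.lt_succ_iff]
    have hxp := h.last x (by omega)
    have h5 := (h.lt_iff hw hxp).mpr (by omega)
    have h6 := (hw.lt_iff_boxIndex_lt h1 h2 hxp).not.mpr (by omega)
    rw [Fin.lt_def] at h5 h6
    have : x = y := w.injective (Fin.ext (by omega))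
    rw [this] at hxp
    exact absurd h1 (not_lt.mpr hxp)

end IsCornerBox

/-- Every essential box of a vexillary permutation is a corner box. -/
theorem IsVexillary.exists_of_mem_essentialSet {w : Equiv.Perm (Fin n)} (hw : IsVexillary w)
    {c : ℕ × ℕ} (hc : c ∈ essentialSet w) :
    ∃ j P Y, IsCornerBox w j P Y ∧ colHeight w (j + 1) < colHeight w j ∧
      ((P : ℕ), (w Y : ℕ)) = c := by
  rw [essentialSet, Finset.mem_filter] at hc
  obtain ⟨c1, c2⟩ := c
  obtain ⟨hd, hdown, hright⟩ := hc
  obtain ⟨p, y, hpy, hyp, rfl, rfl⟩ := mem_diagram.mp hd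
  simp only at hdown hright
  -- the position `u` of the value `w y + 1`
  obtain ⟨u, hu⟩ : ∃ u, (w u : ℕ) = w y + 1 := by
    refine ⟨w.symm ⟨w y + 1, ?_⟩, by simp⟩
    have := Fin.lt_def.mp hyp
    omega
  have hlt_u : ∀ z, w z < w u ↔ w z ≤ w y := fun z => by
    rw [Fin.lt_def, Fin.le_def, hu, Nat.lt_succ_iff]
  have hyu : w y < w u := (hlt_u y).mpr le_rfl
  have hup : u ≤ p := by
    by_contra hlt
    rw [← hu] at hright
    refine hright (mem_diagram_coe.mpr ⟨not_le.mp hlt, lt_of_le_of_ne ?_ ?_⟩)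
    · rw [Fin.le_def, hu]
      exact hyp
    · simp [(not_le.mp hlt).ne']
  have hcard := card_le_eq_boxIndex (w := w) hpy
  have hlast : ∀ x, boxIndex w p y < code w x → x ≤ p := by
    intro x hx
    by_contra! hpx
    have hpn : (p : ℕ) + 1 < n := by
      have := Fin.lt_def.mp hpx
      omega
    set p' : Fin n := ⟨p + 1, hpn⟩ with hp'
    have hpp' : p < p' := Fin.lt_def.mpr (by simp [hp'])
    have hp'y : w p' ≤ w y := by
      by_contra! hlt
      have hne : p' ≠ y := fun e => by rw [e] at hlt; exact lt_irrefl _ hlt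
      refine hdown (mem_diagram_coe (p := p').mpr ⟨lt_of_le_of_ne ?_ hne, hlt⟩)
      rw [Fin.le_def]
      exact Fin.lt_def.mp hpy
    have hyx : w y < w x := by
      by_contra! hle
      refine absurd hx (not_lt.mpr (Finset.card_le_card
        (Finset.monotone_filter_right _ fun z _ hz => ⟨hpx.trans hz.1, hz.2.trans_le hle⟩)))
    have hp'x : p' < x := by
      refine lt_of_le_of_ne (Fin.le_def.mpr (Fin.lt_def.mp hpx)) fun e => ?_
      rw [e] at hp'y
      exact absurd hyx (not_lt.mpr hp'y)
    have hup' : u < p' := hup.trans_lt hpp'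
    have hp'u : w p' < w u := (hlt_u p').mpr hp'y
    have hux : w u < w x := by
      refine lt_of_le_of_ne ?_ (by simp [(hup'.trans hp'x).ne])
      rw [Fin.le_def, hu]
      exact hyx
    have hsub : insert p' ({d : Fin n | x < d ∧ w d < w x} : Finset (Fin n))
        ⊆ ({z : Fin n | p < z ∧ w z ≤ w y} : Finset (Fin n)) := by
      intro d hd
      simp only [Finset.mem_insert, Finset.mem_filter, Finset.mem_univ, true_and] at hd ⊢
      rcases hd with rfl | hd
      · exact ⟨hpp', hp'y⟩
      · exact ⟨hpx.trans hd.1, (hlt_u d).mp (hw.lt_of_lt hup' hp'x hp'u hd.1 hd.2)⟩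
    have h1 := Finset.card_le_card hsub
    rw [Finset.card_insert_of_notMem (by simp [hp'x.le])] at h1
    change code w x + 1 ≤ _ at h1
    omega
  refine ⟨boxIndex w p y, p, y, ⟨hpy, hyp, rfl, hlast⟩, ?_, rfl⟩
  have hcard' : Finset.card {z : Fin n | p < z ∧ w z < w u} = boxIndex w p y + 1 := by
    rw [← hcard]
    exact congrArg Finset.card (Finset.filter_congr fun z _ => by rw [hlt_u])
  have hex : ∃ x, code w x = boxIndex w p y + 1 := by
    rcases hup.lt_or_eq with hup | rfl
    · have hwup : w u < w p := by
        refine lt_of_le_of_ne ?_ (by simp [hup.ne])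
        rw [Fin.le_def, hu]
        exact hyp
      by_cases hl : ∃ l, u < l ∧ l < p ∧ w l < w u
      · obtain ⟨l, h1, h2, h3⟩ := hl
        refine ⟨p, ?_⟩
        rw [← hcard', code]
        exact congrArg Finset.card (Finset.filter_congr fun z _ => and_congr_right fun h4 =>
          ⟨fun h5 => hw.lt_of_lt h1 h2 h3 h4 h5, fun h5 => h5.trans hwup⟩)
      · push Not at hl
        refine ⟨u, ?_⟩
        rw [← hcard']
        exact code_eq_card_of_forall hup hwup fun l h1 h2 =>
          lt_of_le_of_ne (hl l h1 h2) (by simp [h1.ne])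
    · exact ⟨u, hcard'⟩
  obtain ⟨x, hx⟩ := hex
  have := colHeight_lt_of_code_eq (Nat.lt_succ_self _) hx
  exact this

theorem colLen_codeShape (w : Equiv.Perm (Fin n)) : (codeShape w).colLen 0 = colHeight w 0 := by
  have h : ∀ i, i < (codeShape w).colLen 0 ↔ i < colHeight w 0 := fun i =>
    YoungDiagram.mem_iff_lt_colLen.symm.trans mem_codeShape
  have h1 := h (colHeight w 0)
  have h2 := h ((codeShape w).colLen 0)
  omega

/-- A flagging set contains the corner boxes that end the blocks of equal rows. Going up by `d` rows
within a block lowers the flag by at most `d`, since all rows passed have a dot to the right. -/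
theorem IsFlaggingSet.isRowBound {w : Equiv.Perm (Fin n)} (hw : IsVexillary w) {p q : ℕ → ℕ}
    (h : IsFlaggingSet w (colHeight w 0) p q) : IsRowBound w fun i => p i + 1 := by
  have hdots : ∀ i, i < colHeight w 0 → dotsAbove w (p i) (q i) = i + 1 := fun i hi => by
    have h1 := h.rank_eq i hi
    have h2 := rank_add_dotsAbove w (q i) (h.mem_grid i hi).1
    omega
  have hcorner : ∀ {j P Y}, IsCornerBox w j P Y → colHeight w (j + 1) < colHeight w j →
      ∀ i, i + 1 = colHeight w j → i < colHeight w 0 ∧ p i = P ∧ q i = w Y := by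
    intro j P Y hPY hj i hi
    obtain ⟨i', hi', heq⟩ := h.essentialSet_subset _ (hPY.mem_essentialSet hw hj)
    obtain ⟨h1, h2⟩ := Prod.mk.inj heq
    have h3 := hdots i' hi'
    rw [h1, h2, hPY.dotsAbove_eq hw] at h3
    obtain rfl : i = i' := by omega
    exact ⟨hi', h1, h2⟩
  constructor
  · intro i j h1 h2
    obtain ⟨P, Y, hPY⟩ := exists_isCornerBox (w := w) (j := j) (by omega)
    obtain ⟨-, h3, -⟩ := hcorner hPY (by omega) i h1
    simp only [h3]
    rw [hPY.colBound_eq]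
  · intro i d j h1 h2
    -- row `i + d` ends the block of row `i`
    obtain ⟨P, Y, hPY⟩ := exists_isCornerBox (w := w) (j := j) (by omega)
    obtain ⟨h3, h4, h5⟩ := hcorner hPY (by omega) (i + d) h1
    have hp := h.p_mono i (i + d) (by omega) h3
    have hq := h.q_anti i (i + d) (by omega) h3
    rw [h4] at hp
    rw [h5] at hq
    -- among the dots counted for row `i` there is one in a row with exactly `j + 1` boxes
    have hex : ∃ x : Fin n, (x : ℕ) ≤ p i ∧ q i < (w x : ℕ) ∧ ¬ j + 1 < code w x := by
      by_contra! hall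
      have h6 : dotsAbove w (p i) (q i) ≤ colHeight w (j + 1) :=
        Finset.card_le_card (Finset.monotone_filter_right _ fun x _ hx => hall x hx.1 hx.2)
      rw [hdots i (by omega)] at h6
      omega
    obtain ⟨x, hx1, hx2, hx3⟩ := hex
    have hxP : x ≤ P := Fin.le_def.mpr (hx1.trans hp)
    have hYx : w Y < w x := Fin.lt_def.mpr (hq.trans_lt hx2)
    have hxc := (hPY.lt_iff hw hxP).mp hYx
    have hall : ∀ z, x < z → z ≤ P → w Y < w z := by
      intro z hz1 hz2
      by_contra! hcon
      have hsub : insert z ({d : Fin n | P < d ∧ w d ≤ w Y} : Finset (Fin n))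
          ⊆ ({d : Fin n | x < d ∧ w d < w x} : Finset (Fin n)) := by
        intro d hd
        simp only [Finset.mem_insert, Finset.mem_filter, Finset.mem_univ, true_and] at hd ⊢
        rcases hd with rfl | hd
        · exact ⟨hz1, hcon.trans_lt hYx⟩
        · exact ⟨hxP.trans_lt hd.1, hd.2.trans_lt hYx⟩
      have h6 := Finset.card_le_card hsub
      rw [Finset.card_insert_of_notMem (by simp [not_lt.mpr hz2]), card_le_eq_boxIndex hPY.lt,
        hPY.index] at h6
      change j + 1 + 1 ≤ code w x at h6
      omega
    have hcount : dotsAbove w (p i) (q i) + (P - p i) ≤ dotsAbove w P (w Y) := by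
      have hpn : p i < n := hp.trans_lt P.isLt
      have h7 : P - p i = (Finset.Ioc (⟨p i, hpn⟩ : Fin n) P).card := by simp
      rw [h7, dotsAbove, dotsAbove, ← Finset.card_union_of_disjoint]
      · refine Finset.card_le_card fun z hz => ?_
        simp only [Finset.mem_union, Finset.mem_filter, Finset.mem_univ, true_and,
          Finset.mem_Ioc] at hz ⊢
        rcases hz with hz | hz
        · omega
        · have := hall z (Fin.lt_def.mpr (hx1.trans_lt (Fin.lt_def.mp hz.1))) hz.2
          exact ⟨Fin.le_def.mp hz.2, Fin.lt_def.mp this⟩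
      · rw [Finset.disjoint_left]
        intro z hz hz'
        simp only [Finset.mem_filter, Finset.mem_univ, true_and, Finset.mem_Ioc, Fin.lt_def]
          at hz hz'
        omega
    rw [hdots i (by omega), hPY.dotsAbove_eq hw] at hcount
    rw [hPY.colBound_eq]
    omega

/-! ### Existence of flagging sets -/

theorem exists_eq_of_succ_le {f : ℕ → ℕ} (hf : ∀ t, f (t + 1) ≤ f t + 1) {a b v : ℕ}
    (hab : a ≤ b) (ha : f a ≤ v) (hb : v ≤ f b) : ∃ t, a ≤ t ∧ t ≤ b ∧ f t = v := by
  induction b, hab using Nat.le_induction with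
  | base => exact ⟨a, le_rfl, le_rfl, by omega⟩
  | succ b hab ih =>
    by_cases h : v ≤ f b
    · obtain ⟨t, h1, h2, h3⟩ := ih h
      exact ⟨t, h1, by omega, h3⟩
    · have := hf b
      exact ⟨b + 1, by omega, le_rfl, by omega⟩

theorem exists_eq_of_le_succ {f : ℕ → ℕ} (hf : ∀ t, f t ≤ f (t + 1) + 1) {a b v : ℕ}
    (hab : a ≤ b) (ha : v ≤ f a) (hb : f b ≤ v) : ∃ t, a ≤ t ∧ t ≤ b ∧ f t = v := by
  induction b, hab using Nat.le_induction with
  | base => exact ⟨a, le_rfl, le_rfl, by omega⟩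
  | succ b hab ih =>
    by_cases h : f b ≤ v
    · obtain ⟨t, h1, h2, h3⟩ := ih h
      exact ⟨t, h1, by omega, h3⟩
    · have := hf b
      exact ⟨b + 1, by omega, le_rfl, by omega⟩

/-- On the lattice path from `(p₀, q₀)` to `(p₁, q₁)` with its turn at `(p₀, q₁)`, the function
`dotsAbove` takes every intermediate value, and its end value at the end. -/
theorem exists_dotsAbove_eq (w : Equiv.Perm (Fin n)) {p₀ q₀ p₁ q₁ v : ℕ} (hp : p₀ ≤ p₁)
    (hq : q₁ ≤ q₀) (h0 : dotsAbove w p₀ q₀ ≤ v) (h1 : v ≤ dotsAbove w p₁ q₁) :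
    ∃ p q, p₀ ≤ p ∧ p ≤ p₁ ∧ q₁ ≤ q ∧ q ≤ q₀ ∧ (p = p₀ ∨ q = q₁) ∧ dotsAbove w p q = v ∧
      (v = dotsAbove w p₁ q₁ → p = p₁ ∧ q = q₁) := by
  by_cases hv : v = dotsAbove w p₁ q₁
  · exact ⟨p₁, q₁, hp, le_rfl, le_rfl, hq, Or.inr rfl, hv.symm, fun _ => ⟨rfl, rfl⟩⟩
  by_cases hturn : v ≤ dotsAbove w p₀ q₁
  · obtain ⟨q, h2, h3, h4⟩ := exists_eq_of_le_succ (dotsAbove_le_succ_right w p₀) hq hturn h0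
    exact ⟨p₀, q, le_rfl, hp, h2, h3, Or.inl rfl, h4, fun h => absurd h hv⟩
  · obtain ⟨p, h2, h3, h4⟩ := exists_eq_of_succ_le (f := fun t => dotsAbove w t q₁)
      (fun t => dotsAbove_succ_left_le w t q₁) hp (not_le.mp hturn).le h1
    exact ⟨p, q₁, h2, h3, le_rfl, hq, Or.inr rfl, h4, fun h => absurd h hv⟩

/-- The corner boxes of a vexillary permutation run from southwest to northeast. -/
theorem IsCornerBox.apply_le {w : Equiv.Perm (Fin n)} (hw : IsVexillary w) {j j' : ℕ}
    {P Y P' Y' : Fin n} (h : IsCornerBox w j P Y) (h' : IsCornerBox w j' P' Y') (hj : j ≤ j')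
    (hjc : colHeight w (j' + 1) < colHeight w j') : w Y ≤ w Y' := by
  rcases (h'.le_of_le h hj).lt_or_eq with hlt | heq
  · by_contra! hY
    have hess := h'.mem_essentialSet hw hjc
    rw [essentialSet, Finset.mem_filter] at hess
    obtain ⟨-, hdown, hright⟩ := hess
    have hPn : (P' : ℕ) + 1 < n := by
      have := Fin.lt_def.mp hlt
      omega
    set y : Fin n := ⟨P' + 1, hPn⟩ with hy
    have hP'y : P' < y := Fin.lt_def.mpr (by simp [hy])
    have hyY' : w y ≤ w Y' := by
      by_contra! hcon
      have hne : y ≠ Y' := fun e => by rw [e] at hcon; exact lt_irrefl _ hcon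
      exact hdown (mem_diagram_coe (p := y).mpr
        ⟨lt_of_le_of_ne (Fin.le_def.mpr (Fin.lt_def.mp h'.lt)) hne, hcon⟩)
    obtain ⟨u, hu⟩ : ∃ u, (w u : ℕ) = w Y' + 1 := by
      refine ⟨w.symm ⟨w Y' + 1, ?_⟩, by simp⟩
      have := Fin.lt_def.mp h'.apply_lt
      omega
    have huP : u ≤ P' := by
      by_contra hcon
      simp only at hright
      rw [← hu] at hright
      refine hright (mem_diagram_coe.mpr ⟨not_le.mp hcon, lt_of_le_of_ne ?_ ?_⟩)
      · rw [Fin.le_def, hu]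
        exact h'.apply_lt
      · simp [(not_le.mp hcon).ne']
    have hyu : w y < w u := by
      rw [Fin.lt_def, hu]
      exact Nat.lt_succ_of_le hyY'
    have hyP : y < P := by
      refine lt_of_le_of_ne (Fin.le_def.mpr (Fin.lt_def.mp hlt)) fun e => ?_
      rw [e] at hyY'
      exact lt_asymm (h.apply_lt.trans_le hyY') hY
    have huY : w u < w Y := by
      refine lt_of_le_of_ne ?_ ?_
      · rw [Fin.le_def, hu]
        exact hY
      · simp [(huP.trans_lt (hlt.trans h.lt)).ne]
    exact hw.false_of (huP.trans_lt hP'y) hyP h.lt hyu huY h.apply_lt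
  · subst heq
    exact h'.apply_le_of_eq h hj

theorem dotsAbove_zero_last (w : Equiv.Perm (Fin n)) : dotsAbove w 0 (n - 1) = 0 := by
  rw [dotsAbove, Finset.card_eq_zero, Finset.filter_eq_empty_iff]
  intro x _
  omega

/-- The boxes of a flagging set can be taken from a lattice path through all essential boxes. -/
theorem IsVexillary.exists_isFlaggingSet {w : Equiv.Perm (Fin n)} (hw : IsVexillary w) :
    ∃ p q, IsFlaggingSet w (colHeight w 0) p q := by
  -- the last column `J i` of row `i`, and the corner box that ends the block of row `i`
  set J : ℕ → ℕ := fun i => (codeShape w).rowLen i - 1 with hJ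
  have hJspec : ∀ i, i < colHeight w 0 → i < colHeight w (J i) ∧ colHeight w (J i + 1) ≤ i := by
    intro i hi
    have h1 := (YoungDiagram.mem_iff_lt_rowLen (μ := codeShape w)).mp (mem_codeShape.mpr hi)
    constructor
    · exact mem_codeShape.mp ((YoungDiagram.mem_iff_lt_rowLen (μ := codeShape w)).mpr
        (by simp only [hJ]; omega))
    · by_contra hlt
      have := (YoungDiagram.mem_iff_lt_rowLen (μ := codeShape w)).mp
        (mem_codeShape.mpr (not_le.mp hlt))
      simp only [hJ] at this
      omega
  have hJeq : ∀ i j, i < colHeight w j → colHeight w (j + 1) ≤ i → J i = j := fun i j h1 h2 => by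
    simp only [hJ, rowLen_codeShape h1 h2, Nat.add_sub_cancel]
  have hJanti : Antitone J := fun i i' h =>
    Nat.sub_le_sub_right ((codeShape w).rowLen_anti i i' h) 1
  have hbox : ∀ j, ∃ P Q : ℕ, 0 < colHeight w j → ∃ P' Y' : Fin n,
      IsCornerBox w j P' Y' ∧ P = P' ∧ Q = w Y' := by
    intro j
    by_cases hj : 0 < colHeight w j
    · obtain ⟨P, Y, h⟩ := exists_isCornerBox hj
      exact ⟨P, w Y, fun _ => ⟨P, Y, h, rfl, rfl⟩⟩
    · exact ⟨0, 0, fun h => absurd h hj⟩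
  choose PC QC hPC using hbox
  set P : ℕ → ℕ := fun i => PC (J i) with hP
  set Q : ℕ → ℕ := fun i => QC (J i) with hQ
  have hPQ : ∀ i, i < colHeight w 0 → ∃ P' Y' : Fin n,
      IsCornerBox w (J i) P' Y' ∧ P i = P' ∧ Q i = w Y' := fun i hi =>
    hPC (J i) (by have := hJspec i hi; omega)
  have hPmono : ∀ i i', i ≤ i' → i' < colHeight w 0 → P i ≤ P i' ∧ Q i' ≤ Q i := by
    intro i i' h hi'
    obtain ⟨P₁, Y₁, h1, h2, h3⟩ := hPQ i (by omega)
    obtain ⟨P₂, Y₂, h4, h5, h6⟩ := hPQ i' hi'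
    rw [h2, h3, h5, h6]
    refine ⟨h1.le_of_le h4 (hJanti h), h4.apply_le hw h1 (hJanti h) ?_⟩
    have := hJspec i (by omega)
    omega
  have hdots : ∀ i, i < colHeight w 0 → dotsAbove w (P i) (Q i) = colHeight w (J i) := by
    intro i hi
    obtain ⟨P₁, Y₁, h1, h2, h3⟩ := hPQ i hi
    rw [h2, h3, h1.dotsAbove_eq hw]
  have hlt : ∀ i, i < colHeight w 0 → P i < n ∧ Q i < n := by
    intro i hi
    obtain ⟨P₁, Y₁, h1, h2, h3⟩ := hPQ i hi
    omega
  -- the corner box of the previous block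
  have hprev : ∀ j, ∃ p₀ q₀ : ℕ, ∀ i, J i = j → i < colHeight w 0 →
      p₀ ≤ P i ∧ Q i ≤ q₀ ∧ q₀ < n ∧ dotsAbove w p₀ q₀ = colHeight w (j + 1) ∧
      ∀ i' < colHeight w (j + 1), P i' ≤ p₀ ∧ q₀ ≤ Q i' := by
    intro j
    by_cases h0 : colHeight w (j + 1) = 0
    · refine ⟨0, n - 1, fun i _ hi => ⟨Nat.zero_le _, ?_, ?_, ?_, fun i' h => by omega⟩⟩
      · have := hlt i hi
        omega
      · have := hlt i hi
        omega
      · rw [dotsAbove_zero_last, h0]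
    · set i₀ := colHeight w (j + 1) - 1 with hi₀
      refine ⟨P i₀, Q i₀, fun i hij hi => ?_⟩
      have hs := hJspec i hi
      rw [hij] at hs
      have hs₀ := hJspec i₀ (by omega)
      have hJ₀ : j + 1 ≤ J i₀ := by
        by_contra hcon
        have := colHeight_anti w (show J i₀ + 1 ≤ j + 1 by omega)
        omega
      have hm := hPmono i₀ i (by omega) hi
      refine ⟨hm.1, hm.2, (hlt i₀ (by omega)).2, ?_, fun i' h => ?_⟩
      · rw [hdots i₀ (by omega)]
        have := colHeight_anti w hJ₀
        omega
      · exact hPmono i' i₀ (by omega) (by omega)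
  choose P₀ Q₀ hPQ₀' using hprev
  have hPQ₀ := fun i => hPQ₀' (J i) i rfl
  have hchoice : ∀ i, ∃ p q : ℕ, i < colHeight w 0 → P₀ (J i) ≤ p ∧ p ≤ P i ∧ Q i ≤ q ∧ q ≤ Q₀ (J i) ∧
      dotsAbove w p q = i + 1 ∧ (i + 1 = colHeight w (J i) → p = P i ∧ q = Q i) ∧
      (p = P₀ (J i) ∨ q = Q i) := by
    intro i
    by_cases hi : i < colHeight w 0
    · obtain ⟨h1, h2, h3, h4, h5⟩ := hPQ₀ i hi
      have hs := hJspec i hi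
      obtain ⟨p, q, h6, h7, h8, h9, h10, h11, h12⟩ :=
        exists_dotsAbove_eq w (v := i + 1) h1 h2 (by omega) (by rw [hdots i hi]; omega)
      rw [hdots i hi] at h12
      exact ⟨p, q, fun _ => ⟨h6, h7, h8, h9, h11, h12, h10⟩⟩
    · exact ⟨0, 0, fun h => absurd h hi⟩
  choose p q hpq using hchoice
  have hmono : ∀ i i', i ≤ i' → i' < colHeight w 0 → p i ≤ p i' ∧ q i' ≤ q i := by
    intro i i' hii hi'
    rcases hii.lt_or_eq with hlt' | rfl
    swap
    · exact ⟨le_rfl, le_rfl⟩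
    have hi : i < colHeight w 0 := by omega
    obtain ⟨h1, h2, h3, h4, h5, -, h6⟩ := hpq i hi
    obtain ⟨h1', h2', h3', h4', h5', -, h6'⟩ := hpq i' hi'
    have hs := hJspec i hi
    have hs' := hJspec i' hi'
    rcases Nat.lt_or_ge i (colHeight w (J i' + 1)) with hb | hb
    · obtain ⟨-, -, -, -, h7⟩ := hPQ₀ i' hi'
      have := h7 i hb
      omega
    · -- both rows lie in the same block
      have hJJ : J i = J i' := hJeq i (J i') (by omega) hb
      have hPP : P i = P i' := congrArg PC hJJ
      have hQQ : Q i = Q i' := congrArg QC hJJ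
      rw [← hJJ] at h1' h4' h6'
      have hcon : ¬ (p i' ≤ p i ∧ q i ≤ q i') := fun h => by
        have := dotsAbove_mono w h.1 h.2
        omega
      omega
  refine ⟨p, q, ⟨fun i hi => ?_, ?_, fun i i' h h' => (hmono i i' h h').1,
    fun i i' h h' => (hmono i i' h h').2, fun i hi => ?_⟩⟩
  · obtain ⟨-, h2, -, h4, -⟩ := hpq i hi
    obtain ⟨-, -, h5, -⟩ := hPQ₀ i hi
    have := hlt i hi
    omega
  · intro c hc
    obtain ⟨j, P', Y', h1, h2, rfl⟩ := hw.exists_of_mem_essentialSet hc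
    have hanti := colHeight_anti w (Nat.zero_le j)
    have hi : colHeight w j - 1 < colHeight w 0 := by omega
    have hJi : J (colHeight w j - 1) = j := hJeq _ _ (by omega) (by omega)
    refine ⟨colHeight w j - 1, hi, ?_⟩
    obtain ⟨-, -, -, -, -, h3, -⟩ := hpq _ hi
    obtain ⟨h4, h5⟩ := h3 (by rw [hJi]; omega)
    obtain ⟨P₁, Y₁, h6, h7, h8⟩ := hPQ _ hi
    rw [hJi] at h6
    obtain ⟨rfl, rfl⟩ := h6.unique h1
    rw [h4, h5, h7, h8]
  · obtain ⟨-, h2, -, -, h5, -⟩ := hpq i hi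
    have h6 := hlt i hi
    have h7 := rank_add_dotsAbove w (q i) (show p i < n by omega)
    omega

end FlaggedGrothendieck

theorem theorem3p1 (n : ℕ) (w : Equiv.Perm (Fin n)) (hw : FlaggedGrothendieck.IsVexillary w) :
    (∃! μ : YoungDiagram, FlaggedGrothendieck.IsShape w μ) ∧
    ∀ μ : YoungDiagram, FlaggedGrothendieck.IsShape w μ →
      (∃ p q : ℕ → ℕ, FlaggedGrothendieck.IsFlaggingSet w (μ.colLen 0) p q) ∧
      ∀ p q : ℕ → ℕ, FlaggedGrothendieck.IsFlaggingSet w (μ.colLen 0) p q →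
        FlaggedGrothendieck.grothendieck w = FlaggedGrothendieck.flaggedGrothendieck μ p := by
  have hshape := hw.isShape_codeShape
  refine ⟨⟨_, hshape, fun ν hν => hν.unique hshape⟩, fun μ hμ => ?_⟩
  obtain rfl := hμ.unique hshape
  rw [FlaggedGrothendieck.colLen_codeShape]
  refine ⟨hw.exists_isFlaggingSet, fun p q h => ?_⟩
  rw [FlaggedGrothendieck.flaggedGrothendieck_eq_tabSum]
  exact FlaggedGrothendieck.grothendieck_eq_tabSum hw (h.isRowBound hw)
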